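/- Let $d \ge 2$ and consider nearest-neighbour site percolation on $\mathbb Z^d$: each site is, independently of the others, open with probability $p$ and closed with probability $1-p$; let $P_p$ be the corresponding product measure, let $\theta(p)$ be the $P_p$-probability that the origin belongs to an infinite open cluster, and let $p_c = p_c(d) = \sup\{p \in [0,1] : \theta(p) = 0\}$. Let $\Lambda(n) = [-n,n]^d \cap \mathbb Z^d$ and $\partial\Lambda(n) = \{x \in \Lambda(n) : \|x\| = n\}$, where $\|x\| = \max_{1\le i\le d}|x_i|$. For integers $0 \le m \le n$ let $A_2(m,n)$ be the event that in $\Lambda(n)$ there are two distinct open clusters (connected components of the set of open sites of $\Lambda(n)$, where connections use only open paths inside $\Lambda(n)$), each of which contains a site of $\Lambda(m)$ and a site of $\partial\Lambda(n)$. Then for every integer $M \ge 2$ there are a constant $\delta = \delta(d,M) > 0$ and an infinite sequence of integers $1 = n_1 < n_2 < \cdots$ such that $n_{i+1}/n_i \le 8M$ for all $i$, and $$P_{p_c}\bigl(A_2(n_i, M n_i)\bigr) \ge \delta \quad \text{for all } i.$$ -/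

import Mathlib

open MeasureTheory ProbabilityTheory

noncomputable section

namespace SitePercolation

/-- The nearest-neighbour graph on `ℤ^d`: two sites are adjacent when their `ℓ¹`-distance is `1`. -/
def lattice (d : ℕ) : SimpleGraph (Fin d → ℤ) where
  Adj x y := ∑ i, |x i - y i| = 1
  symm := ⟨fun x y h => by simpa only [abs_sub_comm] using h⟩
  loopless := ⟨fun x h => by simp at h⟩

/-- A configuration declares each site of `ℤ^d` open (`true`) or closed (`false`). -/
abbrev Config (d : ℕ) : Type := (Fin d → ℤ) → Bool

/-- The product measure `P_p`: each site is, independently of the others, open with probability `p`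
and closed with probability `1 - p`. -/
def P (d : ℕ) (p : unitInterval) : Measure (Config d) :=
  Measure.infinitePi fun _ : Fin d → ℤ => bernoulliMeasure true false p

/-- There is an open path from `x` to `y` of which every site (including `x` and `y`) is in `W`. -/
def ConnectedIn {d : ℕ} (ω : Config d) (W : Set (Fin d → ℤ)) (x y : Fin d → ℤ) : Prop :=
  ∃ w : (lattice d).Walk x y, ∀ z ∈ w.support, ω z = true ∧ z ∈ W

/-- The set of all sites that are connected to `x` by an open path in `W`; it is empty if `x` is
closed or not in `W`. -/
def clusterIn {d : ℕ} (ω : Config d) (W : Set (Fin d → ℤ)) (x : Fin d → ℤ) : Set (Fin d → ℤ) :=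
  {y | ConnectedIn ω W x y}

/-- `C` is an open cluster in `W`: the cluster of some open site of `W`. -/
def IsOpenCluster {d : ℕ} (ω : Config d) (W C : Set (Fin d → ℤ)) : Prop :=
  ∃ x ∈ W, ω x = true ∧ C = clusterIn ω W x

/-- `θ(p)`: the probability that the origin belongs to an infinite open cluster. -/
def theta (d : ℕ) (p : unitInterval) : ℝ :=
  (P d p).real {ω | (clusterIn ω Set.univ 0).Infinite}

/-- The critical probability `p_c(d) = sup {p ∈ [0,1] : θ(p) = 0}`. -/
def criticalProb (d : ℕ) : unitInterval :=
  sSup {p : unitInterval | theta d p = 0}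

/-- The box `Λ(n) = [-n,n]^d`. -/
def box (d n : ℕ) : Set (Fin d → ℤ) :=
  Set.Icc (fun _ => -(n : ℤ)) (fun _ => (n : ℤ))

/-- The boundary `∂Λ(n)`: the sites of `Λ(n)` of sup norm `n`. -/
def boxBoundary (d n : ℕ) : Set (Fin d → ℤ) :=
  {x ∈ box d n | ‖x‖ = (n : ℝ)}

/-- The event `A₂(m,n)`: in `Λ(n)` there are two distinct open clusters that each connect `Λ(m)`
with `∂Λ(n)`. -/
def twoArmEvent (d m n : ℕ) : Set (Config d) :=
  {ω | ∃ C C' : Set (Fin d → ℤ),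
    IsOpenCluster ω (box d n) C ∧ IsOpenCluster ω (box d n) C' ∧ C ≠ C' ∧
    (C ∩ box d m).Nonempty ∧ (C ∩ boxBoundary d n).Nonempty ∧
    (C' ∩ box d m).Nonempty ∧ (C' ∩ boxBoundary d n).Nonempty}

end SitePercolation

end

namespace SitePercolation

/-! Two finite-size criteria trap `p_c`. First, if `9 ^ d` times the probability of an arm from
`Λ(s)` to the outside of `Λ(2s)` is below 1 at some scale, then `θ = 0`
(`theta_eq_zero_of_arm_small`). Secondly, if at some scale `m` an arm out of `Λ(m)` is very likely
and `A₂(2m, 2Mm)` very unlikely, then `θ > 0` (`theta_pos_of_unique_crossing`): blocks with an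
essentially unique crossing cluster are glued together by a multiscale argument in a coordinate
plane. Both criteria concern probabilities that are continuous in `p`, so both fail at `p_c` at
every scale.

Failure of the first bounds the arm probabilities below. Cutting an arm at its last exit from a half
space moves this bound to arms inside half spaces (`exists_le_real_lowerArm`). Failure of the second
at scale `N` leaves two cases. Either `A₂(2N, 2MN)` has probability at least `η`, or an arm from
`Λ(N)` to distance `(2M+1)N` is absent with probability at least `η`. In the latter case the Harris
inequality shows that a slab of half-width `n = 4MN` is uncrossed inside `Λ(Mn)` with probability
bounded below. Arms on the two sides of the slab and the absence of a crossing depend on disjoint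
sets of sites, hence are independent, and together they force `A₂(n, Mn)`. Thus every `N` has a
successor in `(N, 8MN]`, and iteration from 1 gives the sequence. -/

/-- The event `E` is determined by the states of the sites in `W`. -/
def LocalOn {d : ℕ} (W : Set (Fin d → ℤ)) (E : Set (Config d)) : Prop :=
  ∀ ⦃ω ω' : Config d⦄, (∀ z ∈ W, ω z = ω' z) → ω ∈ E → ω' ∈ E

/-! ### Events depending on finitely many sites: continuity, independence, Harris inequality,
symmetry -/

section Local

variable {d : ℕ} {W W' : Set (Fin d → ℤ)} {E F : Set (Config d)}

theorem LocalOn.mono (h : LocalOn W E) (hW : W ⊆ W') : LocalOn W' E :=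
  fun _ _ hω => h fun z hz => hω z (hW hz)

theorem LocalOn.compl (h : LocalOn W E) : LocalOn W Eᶜ :=
  fun _ _ hω hE hE' => hE (h (fun z hz => (hω z hz).symm) hE')

theorem LocalOn.inter (hE : LocalOn W E) (hF : LocalOn W F) : LocalOn W (E ∩ F) :=
  fun _ _ hω h => ⟨hE hω h.1, hF hω h.2⟩

theorem LocalOn.iUnion {ι : Sort*} {E : ι → Set (Config d)} (h : ∀ i, LocalOn W (E i)) :
    LocalOn W (⋃ i, E i) := by
  intro ω ω' hω hE
  obtain ⟨i, hi⟩ := Set.mem_iUnion.1 hE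
  exact Set.mem_iUnion.2 ⟨i, h i hω hi⟩

instance (p : unitInterval) : IsProbabilityMeasure (P d p) := by
  unfold P; infer_instance

/-- The configuration that agrees with `σ` on `W` and is closed elsewhere. -/
def extend (W : Finset (Fin d → ℤ)) (σ : W → Bool) : Config d :=
  fun z => if h : z ∈ W then σ ⟨z, h⟩ else false

theorem LocalOn.mem_iff_extend {W : Finset (Fin d → ℤ)} (h : LocalOn (W : Set (Fin d → ℤ)) E)
    (ω : Config d) : ω ∈ E ↔ extend W (W.restrict ω) ∈ E := by
  constructor
  · exact fun hE => h (fun z hz => by simp [extend, Finset.mem_coe.1 hz]) hE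
  · exact fun hE => h (fun z hz => by simp [extend, Finset.mem_coe.1 hz]) hE

theorem LocalOn.eq_preimage {W : Finset (Fin d → ℤ)} (h : LocalOn (W : Set (Fin d → ℤ)) E) :
    E = W.restrict ⁻¹' {σ : W → Bool | extend W σ ∈ E} := by
  ext ω
  exact h.mem_iff_extend ω

theorem LocalOn.measurableSet (hW : W.Finite) (h : LocalOn W E) : MeasurableSet E := by
  lift W to Finset (Fin d → ℤ) using hW
  rw [h.eq_preimage]
  exact (Finset.measurable_restrict W) (Set.toFinite _).measurableSet

/-- The probability that a site is in the state `b`. -/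
def siteWeight (p : unitInterval) (b : Bool) : ℝ := if b then (p : ℝ) else 1 - p

theorem siteWeight_nonneg (p : unitInterval) (b : Bool) : 0 ≤ siteWeight p b := by
  unfold siteWeight; split_ifs
  · exact p.2.1
  · linarith [p.2.2]

-- The probability is a polynomial in `p`. This finite sum is the source of both continuity in `p`
-- and the reduction of the Harris inequality to the FKG inequality on a finite cube.
open Classical in
theorem LocalOn.real_eq_sum {W : Finset (Fin d → ℤ)} (h : LocalOn (W : Set (Fin d → ℤ)) E)
    (p : unitInterval) :
    (P d p).real E = ∑ σ : W → Bool, (∏ i, siteWeight p (σ i)) *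
      (if extend W σ ∈ E then 1 else 0) := by
  have h1 : (P d p).real E = (Measure.pi fun _ : W => bernoulliMeasure true false p).real
      {σ : W → Bool | extend W σ ∈ E} := by
    have hS : MeasurableSet {σ : W → Bool | extend W σ ∈ E} := (Set.toFinite _).measurableSet
    conv_lhs => rw [h.eq_preimage]
    rw [← map_measureReal_apply (Finset.measurable_restrict W) hS, P,
      Measure.infinitePi_map_restrict]
  rw [h1]
  have h2 : {σ : W → Bool | extend W σ ∈ E} =
      ((Finset.univ.filter fun σ : W → Bool => extend W σ ∈ E : Finset (W → Bool)) :
        Set (W → Bool)) := by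
    ext σ; simp
  rw [h2, ← sum_measureReal_singleton, Finset.sum_filter]
  refine Finset.sum_congr rfl fun σ _ => ?_
  split_ifs with hσ
  · rw [mul_one, measureReal_def, Measure.pi_singleton, ENNReal.toReal_prod]
    refine Finset.prod_congr rfl fun i _ => ?_
    rw [← measureReal_def]
    cases hi : σ i <;> simp [siteWeight]
  · simp

theorem LocalOn.continuous (hW : W.Finite) (h : LocalOn W E) :
    Continuous fun p : unitInterval => (P d p).real E := by
  lift W to Finset (Fin d → ℤ) using hW
  simp_rw [h.real_eq_sum]
  refine continuous_finsetSum _ fun σ _ => Continuous.mul ?_ continuous_const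
  refine continuous_finsetProd _ fun i _ => ?_
  cases σ i <;> simp only [siteWeight] <;> simp <;> fun_prop

theorem LocalOn.real_inter_eq_mul (hW : W.Finite) (hW' : W'.Finite) (hd : Disjoint W W')
    (hE : LocalOn W E) (hF : LocalOn W' F) (p : unitInterval) :
    (P d p).real (E ∩ F) = (P d p).real E * (P d p).real F := by
  lift W to Finset (Fin d → ℤ) using hW
  lift W' to Finset (Fin d → ℤ) using hW'
  have hi : iIndepFun (fun (z : Fin d → ℤ) (ω : Config d) => ω z) (P d p) :=
    iIndepFun_infinitePi (X := fun _ b => b) fun _ => measurable_id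
  have h := hi.indepFun_finset W W' (Finset.disjoint_coe.1 hd) fun z => measurable_pi_apply z
  have h' := h.measure_inter_preimage_eq_mul {σ | extend W σ ∈ E} {σ | extend W' σ ∈ F}
    (Set.toFinite _).measurableSet (Set.toFinite _).measurableSet
  have e1 : (fun (ω : Config d) (i : W) => ω i) ⁻¹' {σ | extend W σ ∈ E} = E :=
    hE.eq_preimage.symm
  have e2 : (fun (ω : Config d) (i : W') => ω i) ⁻¹' {σ | extend W' σ ∈ F} = F :=
    hF.eq_preimage.symm
  rw [e1, e2] at h'
  simp [measureReal_def, h', ENNReal.toReal_mul]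

/-- The **Harris inequality** for increasing events that depend on finitely many sites. -/
theorem LocalOn.harris (hW : W.Finite) (hE : LocalOn W E) (hF : LocalOn W F)
    (hEu : IsUpperSet E) (hFu : IsUpperSet F) (p : unitInterval) :
    (P d p).real E * (P d p).real F ≤ (P d p).real (E ∩ F) := by
  classical
  lift W to Finset (Fin d → ℤ) using hW
  have hext : Monotone (extend (d := d) W) := by
    intro σ τ h z
    by_cases hz : z ∈ W <;> simp [extend, hz]
    exact h _
  have hmono : ∀ {E : Set (Config d)}, IsUpperSet E →
      Monotone fun σ : W → Bool => if extend W σ ∈ E then (1 : ℝ) else 0 := by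
    intro E hE σ τ h
    by_cases h1 : extend W σ ∈ E
    · simp [h1, hE (hext h) h1]
    · simp only [h1, if_false]; split_ifs <;> norm_num
  have key := fkg (α := W → Bool) (μ := fun σ => ∏ i, siteWeight p (σ i))
    (f := fun σ => if extend W σ ∈ E then (1 : ℝ) else 0)
    (g := fun σ => if extend W σ ∈ F then (1 : ℝ) else 0)
    (fun σ => Finset.prod_nonneg fun i _ => siteWeight_nonneg p _)
    (fun σ => by dsimp; split_ifs <;> norm_num) (fun σ => by dsimp; split_ifs <;> norm_num)
    (hmono hEu) (hmono hFu) (fun a b => by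
      simp only [← Finset.prod_mul_distrib]
      refine le_of_eq (Finset.prod_congr rfl fun i _ => ?_)
      cases ha : a i <;> cases hb : b i <;> simp [ha, hb, mul_comm])
  have huniv : ∑ σ : W → Bool, ∏ i, siteWeight p (σ i) = 1 := by
    have := LocalOn.real_eq_sum (W := W) (E := (Set.univ : Set (Config d)))
      (fun _ _ _ _ => trivial) p
    simpa using this.symm
  rw [huniv, one_mul] at key
  rw [hE.real_eq_sum, hF.real_eq_sum, (hE.inter hF).real_eq_sum]
  refine key.trans (le_of_eq (Finset.sum_congr rfl fun σ _ => ?_))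
  by_cases h1 : extend W σ ∈ E <;> by_cases h2 : extend W σ ∈ F <;> simp [h1, h2]

/-- Induction on `s`: Harris together with inclusion-exclusion gives `P((A ∪ B)ᶜ) ≥ P(Aᶜ) P(Bᶜ)` for
increasing `A` and `B`, and unions of increasing events are increasing. -/
theorem LocalOn.prod_le_real_iInter_compl {ι : Type*} (s : Finset ι) {E : ι → Set (Config d)}
    (hW : W.Finite) (hE : ∀ i, LocalOn W (E i)) (hEu : ∀ i, IsUpperSet (E i))
    (p : unitInterval) :
    ∏ i ∈ s, (1 - (P d p).real (E i)) ≤ (P d p).real (⋃ i ∈ s, E i)ᶜ := by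
  classical
  induction s using Finset.induction_on with
  | empty => simp
  | insert a s ha ih =>
    rw [Finset.prod_insert ha, Finset.set_biUnion_insert]
    have hF : LocalOn W (⋃ i ∈ s, E i) := LocalOn.iUnion fun i => LocalOn.iUnion fun _ => hE i
    have hFu : IsUpperSet (⋃ i ∈ s, E i) := isUpperSet_iUnion₂ fun i _ => hEu i
    have h1 := (hE a).harris hW hF (hEu a) hFu p
    have mF := hF.measurableSet hW
    have h2 := measureReal_union_add_inter (μ := P d p) (s := E a) mF (measure_ne_top _ _) (measure_ne_top _ _)
    have h3 := probReal_compl_eq_one_sub (μ := P d p) mF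
    have h4 := probReal_compl_eq_one_sub (μ := P d p) (((hE a).measurableSet hW).union mF)
    have h5 : (P d p).real (E a) ≤ 1 := measureReal_le_one
    have h6 := mul_le_mul_of_nonneg_left ih (sub_nonneg.2 h5)
    refine h6.trans ?_
    rw [h4, h3]
    nlinarith

/-- The law `P_p` is invariant under permutations of the sites. -/
theorem measurePreserving_comp_equiv (p : unitInterval) (e : (Fin d → ℤ) ≃ (Fin d → ℤ)) :
    MeasurePreserving (fun ω : Config d => ω ∘ e) (P d p) (P d p) := by
  refine ⟨measurable_pi_lambda _ fun z => measurable_pi_apply _, ?_⟩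
  have h := Measure.infinitePi_map_piCongrLeft
    (μ := fun _ : Fin d → ℤ => bernoulliMeasure true false p) e.symm
  unfold P
  convert h using 2
  ext ω z
  obtain ⟨y, rfl⟩ := e.symm.surjective z
  rw [MeasurableEquiv.coe_piCongrLeft, Equiv.piCongrLeft_apply_apply]
  simp

/-- Relabelling the sites is a measurable equivalence of configurations, so invariance holds without
measurability of `E`; this covers events about infinite clusters. -/
theorem real_preimage_comp_equiv (p : unitInterval) (e : (Fin d → ℤ) ≃ (Fin d → ℤ))
    (E : Set (Config d)) : (P d p).real {ω | ω ∘ e ∈ E} = (P d p).real E := by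
  let f : Config d ≃ᵐ Config d :=
    { toFun := fun ω => ω ∘ e
      invFun := fun ω => ω ∘ e.symm
      left_inv := fun ω => by ext; simp
      right_inv := fun ω => by ext; simp
      measurable_toFun := measurable_pi_lambda _ fun z => measurable_pi_apply _
      measurable_invFun := measurable_pi_lambda _ fun z => measurable_pi_apply _ }
  have h := MeasurePreserving.measure_preimage_equiv (f := f)
    (measurePreserving_comp_equiv p e) E
  exact congrArg ENNReal.toReal h

theorem real_forall_closed (p : unitInterval) (hW : W.Finite) (hp : p < 1) :
    0 < (P d p).real {ω : Config d | ∀ z ∈ W, ω z = false} := by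
  lift W to Finset (Fin d → ℤ) using hW
  have h : {ω : Config d | ∀ z ∈ (W : Set (Fin d → ℤ)), ω z = false} =
      Set.pi (W : Set (Fin d → ℤ)) fun _ => {false} := by
    ext ω; simp [Set.mem_pi]
  have hp' : (p : ℝ) < 1 := by exact_mod_cast hp
  rw [h, measureReal_def, P, Measure.infinitePi_pi _ fun _ _ => MeasurableSet.singleton _,
    ENNReal.toReal_prod]
  refine Finset.prod_pos fun z _ => ?_
  rw [← measureReal_def]
  simp [hp']

end Local

end SitePercolation

namespace SitePercolation

/-! ### Lattice paths, exits from sets, and arm events -/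

section Connectivity

variable {d : ℕ}

/-- There is a lattice path from `x` to `y` inside `S`. -/
def Joined (S : Set (Fin d → ℤ)) (x y : Fin d → ℤ) : Prop :=
  ∃ w : (lattice d).Walk x y, ∀ z ∈ w.support, z ∈ S

namespace Joined

variable {S S' A : Set (Fin d → ℤ)} {x y z : Fin d → ℤ}

theorem refl (h : x ∈ S) : Joined S x x := ⟨.nil, by simpa using h⟩

theorem mono (h : Joined S x y) (hS : S ⊆ S') : Joined S' x y :=
  h.imp fun _ hw z hz => hS (hw z hz)

theorem symm (h : Joined S x y) : Joined S y x := by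
  obtain ⟨w, hw⟩ := h
  exact ⟨w.reverse, by simpa using hw⟩

theorem trans (h : Joined S x y) (h' : Joined S y z) : Joined S x z := by
  obtain ⟨w, hw⟩ := h
  obtain ⟨w', hw'⟩ := h'
  refine ⟨w.append w', fun t ht => ?_⟩
  rcases SimpleGraph.Walk.mem_support_append_iff w w' |>.1 ht with h | h
  exacts [hw t h, hw' t h]

theorem left_mem (h : Joined S x y) : x ∈ S := by
  obtain ⟨w, hw⟩ := h
  exact hw x w.start_mem_support

theorem right_mem (h : Joined S x y) : y ∈ S := h.symm.left_mem

theorem of_adj (hx : x ∈ S) (hy : y ∈ S) (h : (lattice d).Adj x y) : Joined S x y :=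
  ⟨.cons h .nil, by simp [hx, hy]⟩

theorem first_exit (h : Joined S x y) (hx : x ∈ A) (hy : y ∉ A) :
    ∃ u v, u ∈ A ∧ v ∉ A ∧ (lattice d).Adj u v ∧ Joined (S ∩ A) x u ∧ v ∈ S := by
  obtain ⟨w, hw⟩ := h
  induction w with
  | nil => exact absurd hx hy
  | @cons a b c hab w ih =>
    have ha : a ∈ S := hw a (by simp)
    have hw' : ∀ z ∈ w.support, z ∈ S := fun z hz => hw z (by simp [hz])
    by_cases hb : b ∈ A
    · obtain ⟨u, v, hu, hv, huv, hj, hvS⟩ := ih hb hy hw'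
      exact ⟨u, v, hu, hv, huv, (of_adj (S := S ∩ A) ⟨ha, hx⟩ hj.left_mem hab).trans hj, hvS⟩
    · exact ⟨a, b, hx, hb, hab, refl ⟨ha, hx⟩, hw' b w.start_mem_support⟩

/-- The first exit of the reversed path from `Aᶜ`. The remaining piece avoids `A`, so what it uses
is independent of the states inside `A`. -/
theorem last_exit (h : Joined S x y) (hx : x ∈ A) (hy : y ∉ A) :
    ∃ u v, u ∈ A ∧ v ∉ A ∧ (lattice d).Adj u v ∧ u ∈ S ∧ Joined (S \ A) v y := by
  obtain ⟨u, v, hu, hv, huv, hj, hvS⟩ := h.symm.first_exit (A := Aᶜ) hy (by simpa using hx)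
  exact ⟨v, u, by simpa using hv, hu, huv.symm, hvS, hj.symm⟩

theorem map (f : lattice d →g lattice d) (h : Joined S x y) (hf : ∀ z ∈ S, f z ∈ S') :
    Joined S' (f x) (f y) := by
  obtain ⟨w, hw⟩ := h
  refine ⟨w.map f, fun z hz => ?_⟩
  rw [SimpleGraph.Walk.support_map, List.mem_map] at hz
  obtain ⟨t, ht, rfl⟩ := hz
  exact hf t (hw t ht)

end Joined

theorem abs_sub_le_one_of_adj {x y : Fin d → ℤ} (h : (lattice d).Adj x y) (i : Fin d) :
    |x i - y i| ≤ 1 := by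
  have h' : ∑ i, |x i - y i| = 1 := h
  rw [← h']
  exact Finset.single_le_sum (f := fun i => |x i - y i|) (fun _ _ => abs_nonneg _)
    (Finset.mem_univ i)

theorem mem_box {n : ℕ} {x : Fin d → ℤ} : x ∈ box d n ↔ ∀ i, |x i| ≤ n := by
  simp only [box, Set.mem_Icc, Pi.le_def, abs_le, forall_and]

theorem finite_box (n : ℕ) : (box d n).Finite := Set.finite_Icc _ _

theorem box_mono {m n : ℕ} (h : m ≤ n) : box d m ⊆ box d n := fun x hx =>
  mem_box.2 fun i => (mem_box.1 hx i).trans (by exact_mod_cast h)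

theorem notMem_box {n : ℕ} {x : Fin d → ℤ} : x ∉ box d n ↔ ∃ i, (n : ℤ) < |x i| := by
  simp [mem_box]

theorem mem_box_of_adj {n : ℕ} {x y : Fin d → ℤ} (h : (lattice d).Adj x y) (hx : x ∈ box d n) :
    y ∈ box d (n + 1) := by
  refine mem_box.2 fun i => ?_
  have h1 := abs_sub_le_one_of_adj h i
  have h2 := mem_box.1 hx i
  rw [abs_le] at *
  push_cast
  omega

theorem mem_boxBoundary_of_abs_eq {n : ℕ} {x : Fin d → ℤ} (hx : x ∈ box d n) {i : Fin d}
    (hi : |x i| = n) : x ∈ boxBoundary d n := by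
  refine ⟨hx, le_antisymm ?_ ?_⟩
  · refine (pi_norm_le_iff_of_nonneg (Nat.cast_nonneg n)).2 fun j => ?_
    rw [Int.norm_eq_abs]
    exact_mod_cast mem_box.1 hx j
  · refine le_trans (le_of_eq ?_) (norm_le_pi_norm x i)
    rw [Int.norm_eq_abs, ← Int.cast_abs, hi]
    simp

theorem mem_boxBoundary_of_adj {n : ℕ} {x y : Fin d → ℤ} (h : (lattice d).Adj x y)
    (hx : x ∈ box d n) (hy : y ∉ box d n) : x ∈ boxBoundary d n := by
  obtain ⟨i, hi⟩ := notMem_box.1 hy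
  refine mem_boxBoundary_of_abs_eq hx (i := i) (le_antisymm (mem_box.1 hx i) ?_)
  have h1 := abs_sub_le_one_of_adj h i
  have h2 := abs_sub_abs_le_abs_sub (y i) (x i)
  rw [abs_sub_comm] at h2
  omega

/-- Translation by `a`, as an endomorphism of the lattice. -/
def shiftHom (a : Fin d → ℤ) : lattice d →g lattice d where
  toFun z := z + a
  map_rel' {x y} h := by
    have h' : ∑ i, |x i - y i| = 1 := h
    simpa [lattice] using h'

theorem adj_sub {x y : Fin d → ℤ} (h : (lattice d).Adj x y) (a : Fin d → ℤ) :
    (lattice d).Adj (x - a) (y - a) := by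
  rw [sub_eq_add_neg, sub_eq_add_neg]
  exact (shiftHom (-a)).map_adj h

/-- Reflection in the origin, as an endomorphism of the lattice. -/
def negHom : lattice d →g lattice d where
  toFun z := -z
  map_rel' {x y} h := by
    have h' : ∑ i, |x i - y i| = 1 := h
    change ∑ i, |(-x) i - (-y) i| = 1
    rw [← h']
    refine Finset.sum_congr rfl fun i _ => ?_
    rw [abs_sub_comm]
    simp only [Pi.neg_apply]
    congr 1
    ring

theorem ConnectedIn.shift {ω : Config d} {W W' : Set (Fin d → ℤ)} {x y a : Fin d → ℤ}
    (h : ConnectedIn (ω ∘ Equiv.addRight a) W x y) (hW : ∀ z ∈ W, z + a ∈ W') :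
    ConnectedIn ω W' (x + a) (y + a) :=
  Joined.map (shiftHom a) h fun _ hz => ⟨hz.1, hW _ hz.2⟩

theorem ConnectedIn.shift_neg {ω : Config d} {W W' : Set (Fin d → ℤ)} {x y a : Fin d → ℤ}
    (h : ConnectedIn ω W x y) (hW : ∀ z ∈ W, z - a ∈ W') :
    ConnectedIn (ω ∘ Equiv.addRight a) W' (x - a) (y - a) := by
  rw [sub_eq_add_neg, sub_eq_add_neg]
  refine ConnectedIn.shift (W := W) ?_ fun z hz => by rw [← sub_eq_add_neg]; exact hW z hz
  convert h using 1
  ext z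
  simp

theorem ConnectedIn.neg {ω : Config d} {W W' : Set (Fin d → ℤ)} {x y : Fin d → ℤ}
    (h : ConnectedIn (ω ∘ Equiv.neg _) W x y) (hW : ∀ z ∈ W, -z ∈ W') :
    ConnectedIn ω W' (-x) (-y) :=
  Joined.map negHom h fun _ hz => ⟨hz.1, hW _ hz.2⟩

theorem ConnectedIn.mono {ω : Config d} {W W' : Set (Fin d → ℤ)} {x y : Fin d → ℤ}
    (h : ConnectedIn ω W x y) (hW : W ⊆ W') : ConnectedIn ω W' x y :=
  Joined.mono h fun _ hz => ⟨hz.1, hW hz.2⟩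

/-- The event that two sites with a certain relation are connected in `W`. -/
def linkEvent (W : Set (Fin d → ℤ)) (R : (Fin d → ℤ) → (Fin d → ℤ) → Prop) : Set (Config d) :=
  {ω | ∃ x y, R x y ∧ ConnectedIn ω W x y}

theorem localOn_connectedIn (W : Set (Fin d → ℤ)) (x y : Fin d → ℤ) :
    LocalOn W {ω : Config d | ConnectedIn ω W x y} := fun _ _ hω h =>
  Joined.mono h fun z hz => ⟨(hω z hz.2).symm.trans hz.1, hz.2⟩

theorem localOn_linkEvent (W : Set (Fin d → ℤ)) (R : (Fin d → ℤ) → (Fin d → ℤ) → Prop) :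
    LocalOn W (linkEvent W R) := by
  rintro ω ω' hω ⟨x, y, hR, h⟩
  exact ⟨x, y, hR, localOn_connectedIn W x y hω h⟩

theorem isUpperSet_linkEvent (W : Set (Fin d → ℤ)) (R : (Fin d → ℤ) → (Fin d → ℤ) → Prop) :
    IsUpperSet (linkEvent W R) := by
  rintro ω ω' hω ⟨x, y, hR, h⟩
  refine ⟨x, y, hR, Joined.mono h fun z hz => ⟨?_, hz.2⟩⟩
  have := hω z
  rw [hz.1] at this
  exact Bool.eq_true_of_true_le this

/-- The event that inside `W` the box of radius `m` around `c` is connected to the complement of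
the box of radius `n` around `c`. -/
def crossing (W : Set (Fin d → ℤ)) (c : Fin d → ℤ) (m n : ℕ) : Set (Config d) :=
  linkEvent W fun x y => x - c ∈ box d m ∧ y - c ∉ box d n

/-- The box of radius `n` around `c`. -/
def boxAt (c : Fin d → ℤ) (n : ℕ) : Set (Fin d → ℤ) := {z | z - c ∈ box d n}

theorem finite_boxAt (c : Fin d → ℤ) (n : ℕ) : (boxAt c n).Finite :=
  (finite_box n).preimage (sub_left_injective.injOn)

/-- Stop the path at its first exit. The endpoint is one step outside the box of radius `n`, hence
the radius `n + 1`. -/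
theorem crossing_subset_inter {W : Set (Fin d → ℤ)} {c : Fin d → ℤ} {m n : ℕ} (h : m ≤ n) :
    crossing W c m n ⊆ crossing (W ∩ boxAt c (n + 1)) c m n := by
  rintro ω ⟨x, y, ⟨hx, hy⟩, hxy⟩
  obtain ⟨u, v, hu, hv, huv, hj, hvS⟩ := Joined.first_exit (A := boxAt c n) hxy
    (box_mono h hx) hy
  have huv' : (lattice d).Adj (u - c) (v - c) := adj_sub huv c
  refine ⟨x, v, ⟨hx, hv⟩, ?_⟩
  have hu' : u ∈ boxAt c (n + 1) := box_mono (Nat.le_succ n) hu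
  have hj' : Joined {z | ω z = true ∧ z ∈ W ∩ boxAt c (n + 1)} x u :=
    hj.mono fun z hz => ⟨hz.1.1, hz.1.2, box_mono (Nat.le_succ n) hz.2⟩
  exact hj'.trans (.of_adj hj'.right_mem ⟨hvS.1, hvS.2, mem_box_of_adj huv' hu⟩ huv)

theorem localOn_crossing (W : Set (Fin d → ℤ)) (c : Fin d → ℤ) (m n : ℕ) :
    LocalOn W (crossing W c m n) := localOn_linkEvent _ _

/-- The event that the box of radius `m` is connected to the complement of the box of
radius `n`. -/
def armEvent (d m n : ℕ) : Set (Config d) := crossing (box d (n + 1)) 0 m n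

theorem localOn_armEvent (m n : ℕ) : LocalOn (box d (n + 1)) (armEvent d m n) :=
  localOn_linkEvent _ _

theorem shift_mem_armEvent {W : Set (Fin d → ℤ)} {c : Fin d → ℤ} {m n : ℕ} (h : m ≤ n)
    {ω : Config d} (hω : ω ∈ crossing W c m n) : ω ∘ Equiv.addRight c ∈ armEvent d m n := by
  obtain ⟨x, y, ⟨hx, hy⟩, hxy⟩ := crossing_subset_inter h hω
  exact ⟨x - c, y - c, ⟨by simpa using hx, by simpa using hy⟩,
    hxy.shift_neg fun z hz => hz.2⟩

theorem real_crossing_le (p : unitInterval) (W : Set (Fin d → ℤ)) (c : Fin d → ℤ) {m n : ℕ}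
    (h : m ≤ n) : (P d p).real (crossing W c m n) ≤ (P d p).real (armEvent d m n) := by
  rw [← real_preimage_comp_equiv p (Equiv.addRight c) (armEvent d m n)]
  exact measureReal_mono fun ω hω => shift_mem_armEvent h hω

end Connectivity

end SitePercolation

namespace SitePercolation

/-! ### First criterion: a small arm probability at one scale excludes percolation -/

section Subcritical

variable {d : ℕ}

/-- The index set of the sub-boxes that cover a larger box. -/
noncomputable def boxIndex (d k : ℕ) : Finset (Fin d → ℤ) :=
  Fintype.piFinset fun _ => Finset.Icc (-(k : ℤ)) k

theorem mem_boxIndex {k : ℕ} {v : Fin d → ℤ} : v ∈ boxIndex d k ↔ ∀ i, |v i| ≤ k := by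
  simp [boxIndex, abs_le]

theorem card_boxIndex (d k : ℕ) : (boxIndex d k).card = (2 * k + 1) ^ d := by
  rw [boxIndex, Fintype.card_piFinset_const, Int.card_Icc]
  congr 1
  omega

theorem exists_boxIndex {s k : ℕ} (hs : 0 < s) {v : Fin d → ℤ} (hv : ∀ i, |v i| ≤ s * k) :
    ∃ w ∈ boxIndex d k, v - (s : ℤ) • w ∈ box d s := by
  have hs' : (0 : ℤ) < s := by exact_mod_cast hs
  refine ⟨fun i => v i / s, mem_boxIndex.2 fun i => ?_, mem_box.2 fun i => ?_⟩
  · have := abs_le.1 (hv i)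
    refine abs_le.2 ⟨(Int.le_ediv_iff_mul_le hs').2 (by linarith),
      Int.ediv_le_of_le_mul hs' (by linarith)⟩
  · have h1 := Int.emod_add_mul_ediv (v i) s
    have h2 := Int.emod_nonneg (v i) hs'.ne'
    have h3 := Int.emod_lt_of_pos (v i) hs'
    simp only [Pi.sub_apply, Pi.smul_apply, smul_eq_mul]
    rw [abs_le]
    constructor <;> linarith

/-- The path first crosses the annulus between radii `s` and `2s`. After its last exit from the box
of radius `2s+1` it starts within `s` of one of `9 ^ d` grid points, each displaced by at most `4s`
in every coordinate, so it still has to travel `4sk`. The two events live on disjoint sets of sites.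
-/
theorem crossing_succ_subset {W : Set (Fin d → ℤ)} {c : Fin d → ℤ} {s : ℕ} (hs : 0 < s) (k : ℕ) :
    crossing W c s (4 * s * (k + 1)) ⊆
      ⋃ w ∈ boxIndex d 4, crossing (W ∩ boxAt c (2 * s + 1)) c s (2 * s) ∩
        crossing (W \ boxAt c (2 * s + 1)) (c + (s : ℤ) • w) s (4 * s * k) := by
  rintro ω ⟨x, y, ⟨hx, hy⟩, hxy⟩
  have hle : 2 * s + 1 ≤ 4 * s * (k + 1) := by nlinarith [Nat.zero_le (s * k)]
  have hyB : y ∉ boxAt c (2 * s + 1) := fun h => hy (box_mono hle h)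
  have hcross : ω ∈ crossing W c s (2 * s) :=
    ⟨x, y, ⟨hx, fun h => hyB (box_mono (Nat.le_succ _) h)⟩, hxy⟩
  obtain ⟨u, v, hu, hv, huv, -, hj⟩ := Joined.last_exit (A := boxAt c (2 * s + 1)) hxy
    (box_mono (by omega) hx) hyB
  have huv' : (lattice d).Adj (u - c) (v - c) := adj_sub huv c
  have hv' := mem_box.1 (mem_box_of_adj huv' hu)
  -- The exit point lies within `2s + 2 ≤ 4s` of `c`, since `s ≥ 1`.
  obtain ⟨w, hw, hvw⟩ := exists_boxIndex (k := 4) hs (v := v - c) fun i => (hv' i).trans (by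
    push_cast; omega)
  refine Set.mem_biUnion hw ⟨crossing_subset_inter (by omega) hcross, v, y, ⟨?_, ?_⟩,
    hj.mono fun z hz => ⟨hz.1.1, hz.1.2, hz.2⟩⟩
  · rwa [← sub_sub]
  · obtain ⟨i, hi⟩ := notMem_box.1 hy
    refine notMem_box.2 ⟨i, ?_⟩
    have hwi := mem_boxIndex.1 hw i
    have h1 : |(s : ℤ) * w i| ≤ s * 4 := by
      rw [abs_mul, Nat.abs_cast]; exact mul_le_mul_of_nonneg_left hwi (by positivity)
    have h2 : (y - (c + (s : ℤ) • w)) i = (y - c) i - s * w i := by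
      simp; ring
    rw [h2]
    have h3 := abs_sub_abs_le_abs_sub ((y - c) i) (s * w i)
    push_cast at *
    linarith

/-- Each step of the induction peels off an independent annulus. The region and centre are
universally quantified because the rest of the path lives in a smaller region around a new centre.
-/
theorem real_crossing_le_pow (p : unitInterval) {s : ℕ} (hs : 0 < s) (k : ℕ) :
    ∀ (W : Set (Fin d → ℤ)) (_ : W.Finite) (c : Fin d → ℤ),
      (P d p).real (crossing W c s (4 * s * k)) ≤
        (9 ^ d * (P d p).real (armEvent d s (2 * s))) ^ k := by
  induction k with
  | zero => intro W _ c; simp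
  | succ k ih =>
    intro W hW c
    set q := (P d p).real (armEvent d s (2 * s)) with hq
    have hstep : ∀ w ∈ boxIndex d 4,
        (P d p).real (crossing (W ∩ boxAt c (2 * s + 1)) c s (2 * s) ∩
          crossing (W \ boxAt c (2 * s + 1)) (c + (s : ℤ) • w) s (4 * s * k)) ≤
        q * (9 ^ d * q) ^ k := by
      intro w _
      rw [LocalOn.real_inter_eq_mul (hW.subset Set.inter_subset_left)
        (hW.subset Set.sdiff_subset) (Set.disjoint_left.2 fun z h h' => h'.2 h.2)
        (localOn_crossing _ _ _ _) (localOn_crossing _ _ _ _)]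
      exact mul_le_mul (real_crossing_le p _ _ (by omega))
        (ih _ (hW.subset Set.sdiff_subset) _) measureReal_nonneg measureReal_nonneg
    calc (P d p).real (crossing W c s (4 * s * (k + 1)))
        ≤ _ := measureReal_mono (crossing_succ_subset hs k) (measure_ne_top _ _)
      _ ≤ _ := measureReal_biUnion_finset_le _ _
      _ ≤ _ := Finset.sum_le_sum hstep
      _ = _ := by
        rw [Finset.sum_const, card_boxIndex, nsmul_eq_mul]
        push_cast
        ring

theorem crossing_of_infinite_cluster {ω : Config d} (h : (clusterIn ω Set.univ 0).Infinite)
    (m n : ℕ) : ω ∈ crossing Set.univ 0 m n := by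
  obtain ⟨y, hy, hyn⟩ := h.exists_notMem_finite (finite_box n)
  exact ⟨0, y, ⟨by simp [mem_box], by simpa using hyn⟩, hy⟩

theorem theta_eq_zero_of_arm_small (p : unitInterval) {s : ℕ} (hs : 0 < s)
    (h : 9 ^ d * (P d p).real (armEvent d s (2 * s)) < 1) : theta d p = 0 := by
  have hle : ∀ k, theta d p ≤ (9 ^ d * (P d p).real (armEvent d s (2 * s))) ^ k := by
    intro k
    -- For `k = 0` the outer radius would be smaller than `s`, so localization does not apply.
    rcases Nat.eq_zero_or_pos k with rfl | hk
    · rw [pow_zero]; exact measureReal_le_one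
    refine le_trans (measureReal_mono fun ω hω => ?_)
      (real_crossing_le_pow p hs k _ ((finite_boxAt (d := d) 0 (4 * s * k + 1))) 0)
    have := crossing_subset_inter (by nlinarith) (crossing_of_infinite_cluster hω s (4 * s * k))
    simpa using this
  refine le_antisymm (ge_of_tendsto' (tendsto_pow_atTop_nhds_zero_of_lt_one ?_ h) hle)
    measureReal_nonneg
  exact mul_nonneg (by positivity) measureReal_nonneg

end Subcritical

end SitePercolation

namespace SitePercolation

/-! ### Deterministic renormalization on the planar grid of blocks -/

section Multiscale

/-- The sub-block with index `u` of the block `z`, when blocks are divided into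
`(2 * D + 3) × (2 * D + 3)` sub-blocks. -/
def subBlock (D : ℕ) (z u : ℤ × ℤ) : ℤ × ℤ :=
  ((2 * D + 3 : ℤ) * z.1 + u.1, (2 * D + 3 : ℤ) * z.2 + u.2)

/-- A block of level `0` is good when `g` holds; a block of level `k + 1` is good when all its
bad sub-blocks lie close together. -/
def Good (D : ℕ) (g : ℤ × ℤ → Prop) : ℕ → ℤ × ℤ → Prop
  | 0, z => g z
  | k + 1, z => ∀ u ∈ Set.Ico (0 : ℤ) (2 * D + 3) ×ˢ Set.Ico (0 : ℤ) (2 * D + 3),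
      ∀ u' ∈ Set.Ico (0 : ℤ) (2 * D + 3) ×ˢ Set.Ico (0 : ℤ) (2 * D + 3),
      ¬ Good D g k (subBlock D z u) → ¬ Good D g k (subBlock D z u') →
        |u.1 - u'.1| ≤ D ∧ |u.2 - u'.2| ≤ D

/-- All sub-blocks in row `j` of the block `z` are good. -/
def RowGood (D : ℕ) (g : ℤ × ℤ → Prop) (k : ℕ) (z : ℤ × ℤ) (j : ℤ) : Prop :=
  ∀ i ∈ Set.Ico (0 : ℤ) (2 * D + 3), Good D g k (subBlock D z (i, j))

/-- All sub-blocks in column `i` of the block `z` are good. -/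
def ColGood (D : ℕ) (g : ℤ × ℤ → Prop) (k : ℕ) (z : ℤ × ℤ) (i : ℤ) : Prop :=
  ∀ j ∈ Set.Ico (0 : ℤ) (2 * D + 3), Good D g k (subBlock D z (i, j))

/-- The main part of a block: the union of the main parts of the sub-blocks that lie in a good row
or a good column. -/
def mainPart (D : ℕ) (g : ℤ × ℤ → Prop) : ℕ → ℤ × ℤ → Set (ℤ × ℤ)
  | 0, z => {z}
  | k + 1, z => {a | ∃ i ∈ Set.Ico (0 : ℤ) (2 * D + 3), ∃ j ∈ Set.Ico (0 : ℤ) (2 * D + 3),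
      (RowGood D g k z j ∨ ColGood D g k z i) ∧ a ∈ mainPart D g k (subBlock D z (i, j))}

variable {D : ℕ} {g : ℤ × ℤ → Prop} {k : ℕ}

theorem Good.abs_sub_le_of_not_rowGood {z : ℤ × ℤ} (h : Good D g (k + 1) z) {j j' : ℤ}
    (hj : j ∈ Set.Ico (0 : ℤ) (2 * D + 3)) (hj' : j' ∈ Set.Ico (0 : ℤ) (2 * D + 3))
    (hb : ¬ RowGood D g k z j) (hb' : ¬ RowGood D g k z j') : |j - j'| ≤ D := by
  simp only [RowGood, not_forall] at hb hb'
  obtain ⟨i, hi, hbi⟩ := hb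
  obtain ⟨i', hi', hbi'⟩ := hb'
  exact (h (i, j) ⟨hi, hj⟩ (i', j') ⟨hi', hj'⟩ hbi hbi').2

theorem Good.abs_sub_le_of_not_colGood {z : ℤ × ℤ} (h : Good D g (k + 1) z) {i i' : ℤ}
    (hi : i ∈ Set.Ico (0 : ℤ) (2 * D + 3)) (hi' : i' ∈ Set.Ico (0 : ℤ) (2 * D + 3))
    (hb : ¬ ColGood D g k z i) (hb' : ¬ ColGood D g k z i') : |i - i'| ≤ D := by
  simp only [ColGood, not_forall] at hb hb'
  obtain ⟨j, hj, hbj⟩ := hb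
  obtain ⟨j', hj', hbj'⟩ := hb'
  exact (h (i, j) ⟨hi, hj⟩ (i', j') ⟨hi', hj'⟩ hbj hbj').1

/-- Two sets of diameter at most `D` in `[0, 2D+2]` have a common point in their complement. -/
theorem exists_common_of_diam_le {p q : ℤ → Prop}
    (hp : ∀ j ∈ Set.Ico (0 : ℤ) (2 * D + 3), ∀ j' ∈ Set.Ico (0 : ℤ) (2 * D + 3),
      ¬ p j → ¬ p j' → |j - j'| ≤ D)
    (hq : ∀ j ∈ Set.Ico (0 : ℤ) (2 * D + 3), ∀ j' ∈ Set.Ico (0 : ℤ) (2 * D + 3),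
      ¬ q j → ¬ q j' → |j - j'| ≤ D) :
    ∃ j ∈ Set.Ico (0 : ℤ) (2 * D + 3), p j ∧ q j := by
  -- The three test points `0`, `D+1`, `2D+2` are pairwise more than `D` apart, so each predicate
  -- fails at no more than one of them, and one point survives both.
  have h0 : (0 : ℤ) ∈ Set.Ico (0 : ℤ) (2 * D + 3) := ⟨by omega, by omega⟩
  have h1 : (D + 1 : ℤ) ∈ Set.Ico (0 : ℤ) (2 * D + 3) := ⟨by omega, by omega⟩
  have h2 : (2 * D + 2 : ℤ) ∈ Set.Ico (0 : ℤ) (2 * D + 3) := ⟨by omega, by omega⟩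
  have key : ∀ {p : ℤ → Prop}, (∀ j ∈ Set.Ico (0 : ℤ) (2 * D + 3),
      ∀ j' ∈ Set.Ico (0 : ℤ) (2 * D + 3), ¬ p j → ¬ p j' → |j - j'| ≤ D) →
      (p 0 ∨ p (D + 1)) ∧ (p 0 ∨ p (2 * D + 2)) ∧ (p (D + 1) ∨ p (2 * D + 2)) := by
    intro p hp
    refine ⟨?_, ?_, ?_⟩ <;> by_contra! hcon
    · have := abs_le.1 (hp _ h0 _ h1 hcon.1 hcon.2); omega
    · have := abs_le.1 (hp _ h0 _ h2 hcon.1 hcon.2); omega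
    · have := abs_le.1 (hp _ h1 _ h2 hcon.1 hcon.2); omega
  have hp' := key hp
  have hq' := key hq
  by_cases a0 : p 0 ∧ q 0
  · exact ⟨_, h0, a0⟩
  by_cases a1 : p (D + 1) ∧ q (D + 1)
  · exact ⟨_, h1, a1⟩
  exact ⟨_, h2, by tauto⟩

/-- Transitivity is only asked through a middle term satisfying `Q`: linking of blocks composes only
when the middle block has a nonempty main part. -/
theorem link_line {α : Type*} {N : ℤ} {Q : α → Prop} {R : α → α → Prop}
    (hrefl : ∀ a, Q a → R a a) (hsymm : ∀ a b, R a b → R b a)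
    (htrans : ∀ a b c, Q b → R a b → R b c → R a c) {u : ℤ → α}
    (hQ : ∀ i ∈ Set.Ico 0 N, Q (u i)) (hstep : ∀ i, 0 ≤ i → i + 1 < N → R (u i) (u (i + 1)))
    {i j : ℤ} (hi : i ∈ Set.Ico 0 N) (hj : j ∈ Set.Ico 0 N) : R (u i) (u j) := by
  have key : ∀ n : ℕ, (n : ℤ) < N → R (u 0) (u n) := by
    intro n
    induction n with
    | zero => intro h; exact hrefl _ (hQ _ ⟨le_rfl, h⟩)
    | succ n ih =>
      intro h
      push_cast at h ⊢
      exact htrans _ _ _ (hQ _ ⟨by omega, by omega⟩) (ih (by omega))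
        (hstep n (by omega) h)
  have key' : ∀ i ∈ Set.Ico 0 N, R (u 0) (u i) := by
    rintro i ⟨h0, h1⟩
    lift i to ℕ using h0
    exact key i h1
  exact htrans _ _ _ (hQ 0 ⟨le_rfl, hi.1.trans_lt hi.2⟩) (hsymm _ _ (key' i hi)) (key' j hj)

/-- Every site of the main part of `z` is related to every site of the main part of `z'`. -/
def Linked (D : ℕ) (g : ℤ × ℤ → Prop) (R : ℤ × ℤ → ℤ × ℤ → Prop) (k : ℕ) (z z' : ℤ × ℤ) : Prop :=
  ∀ a ∈ mainPart D g k z, ∀ b ∈ mainPart D g k z', R a b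

/-- In a good block the bad rows lie within `D` of each other, as do the bad columns, so good rows
and good columns exist, and they intersect; this ties the whole main part together. Neighbouring
good blocks share a good row or column index, along which they are linked. All the claims are
carried in one induction because each level uses all of them for its sub-blocks. -/
theorem good_mainPart {R : ℤ × ℤ → ℤ × ℤ → Prop} (hsymm : ∀ a b, R a b → R b a)
    (htrans : ∀ a b c, R a b → R b c → R a c) (hrefl : ∀ a, g a → R a a)
    (hstep : ∀ a b, g a → g b → (b = (a.1 + 1, a.2) ∨ b = (a.1, a.2 + 1)) → R a b) (k : ℕ) :
    (∀ z, Good D g k z → (mainPart D g k z).Nonempty ∧ (∀ a ∈ mainPart D g k z, g a) ∧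
      Linked D g R k z z) ∧
    ∀ z z', Good D g k z → Good D g k z' → (z' = (z.1 + 1, z.2) ∨ z' = (z.1, z.2 + 1)) →
      Linked D g R k z z' := by
  induction k with
  | zero =>
    simp only [Good, mainPart, Linked, Set.mem_singleton_iff, forall_eq,
      Set.singleton_nonempty, true_and]
    exact ⟨fun z hz => ⟨hz, hrefl z hz⟩, fun z z' hz hz' h => hstep z z' hz hz' h⟩
  | succ k ih =>
    obtain ⟨ih1, ih2⟩ := ih
    have lsymm : ∀ a b, Linked D g R k a b → Linked D g R k b a :=
      fun a b h x hx y hy => hsymm _ _ (h y hy x hx)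
    have ltrans : ∀ a b c, Good D g k b → Linked D g R k a b → Linked D g R k b c →
        Linked D g R k a c := by
      intro a b c hb h h' x hx y hy
      obtain ⟨t, ht⟩ := (ih1 b hb).1
      exact htrans _ _ _ (h x hx t ht) (h' t ht y hy)
    have lrefl : ∀ a, Good D g k a → Linked D g R k a a := fun a ha => (ih1 a ha).2.2
    have row : ∀ z j, RowGood D g k z j → ∀ i ∈ Set.Ico (0 : ℤ) (2 * D + 3),
        ∀ i' ∈ Set.Ico (0 : ℤ) (2 * D + 3),
        Linked D g R k (subBlock D z (i, j)) (subBlock D z (i', j)) := by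
      intro z j hz i hi i' hi'
      refine link_line (u := fun i => subBlock D z (i, j)) lrefl lsymm ltrans hz ?_ hi hi'
      intro t h0 h1
      refine ih2 _ _ (hz _ ⟨h0, by omega⟩) (hz _ ⟨by omega, h1⟩) (Or.inl ?_)
      simp [subBlock, add_assoc]
    have col : ∀ z i, ColGood D g k z i → ∀ j ∈ Set.Ico (0 : ℤ) (2 * D + 3),
        ∀ j' ∈ Set.Ico (0 : ℤ) (2 * D + 3),
        Linked D g R k (subBlock D z (i, j)) (subBlock D z (i, j')) := by
      intro z i hz j hj j' hj'
      refine link_line (u := fun j => subBlock D z (i, j)) lrefl lsymm ltrans hz ?_ hj hj'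
      intro t h0 h1
      refine ih2 _ _ (hz _ ⟨h0, by omega⟩) (hz _ ⟨by omega, h1⟩) (Or.inr ?_)
      simp [subBlock, add_assoc]
    have hrow : ∀ z, Good D g (k + 1) z → ∀ j ∈ Set.Ico (0 : ℤ) (2 * D + 3),
        ∀ j' ∈ Set.Ico (0 : ℤ) (2 * D + 3),
        ¬ RowGood D g k z j → ¬ RowGood D g k z j' → |j - j'| ≤ D :=
      fun z hz j hj j' hj' => hz.abs_sub_le_of_not_rowGood hj hj'
    have hcol : ∀ z, Good D g (k + 1) z → ∀ j ∈ Set.Ico (0 : ℤ) (2 * D + 3),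
        ∀ j' ∈ Set.Ico (0 : ℤ) (2 * D + 3),
        ¬ ColGood D g k z j → ¬ ColGood D g k z j' → |j - j'| ≤ D :=
      fun z hz j hj j' hj' => hz.abs_sub_le_of_not_colGood hj hj'
    -- every main sub-block is linked to all sub-blocks of every good row and of every good column
    have toRow : ∀ z, Good D g (k + 1) z → ∀ r ∈ Set.Ico (0 : ℤ) (2 * D + 3),
        RowGood D g k z r → ∀ t ∈ Set.Ico (0 : ℤ) (2 * D + 3),
        ∀ i ∈ Set.Ico (0 : ℤ) (2 * D + 3), ∀ j ∈ Set.Ico (0 : ℤ) (2 * D + 3),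
        (RowGood D g k z j ∨ ColGood D g k z i) →
        Linked D g R k (subBlock D z (i, j)) (subBlock D z (t, r)) := by
      intro z hz r hr hrg t ht i hi j hj hm
      rcases hm with hm | hm
      -- One good column suffices, hence the repeated hypothesis: it carries the path from row `j`
      -- to row `r`.
      · obtain ⟨c, hc, hcg, -⟩ := exists_common_of_diam_le (hcol z hz) (hcol z hz)
        exact ltrans _ _ _ (hcg r hr) (ltrans _ _ _ (hcg j hj) (row z j hm i hi c hc)
          (col z c hcg j hj r hr)) (row z r hrg c hc t ht)
      · exact ltrans _ _ _ (hm r hr) (col z i hm j hj r hr) (row z r hrg i hi t ht)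
    have toCol : ∀ z, Good D g (k + 1) z → ∀ c ∈ Set.Ico (0 : ℤ) (2 * D + 3),
        ColGood D g k z c → ∀ t ∈ Set.Ico (0 : ℤ) (2 * D + 3),
        ∀ i ∈ Set.Ico (0 : ℤ) (2 * D + 3), ∀ j ∈ Set.Ico (0 : ℤ) (2 * D + 3),
        (RowGood D g k z j ∨ ColGood D g k z i) →
        Linked D g R k (subBlock D z (i, j)) (subBlock D z (c, t)) := by
      intro z hz c hc hcg t ht i hi j hj hm
      obtain ⟨r, hr, hrg, -⟩ := exists_common_of_diam_le (hrow z hz) (hrow z hz)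
      exact ltrans _ _ _ (hcg r hr) (toRow z hz r hr hrg c hc i hi j hj hm)
        (col z c hcg r hr t ht)
    have h0 : (0 : ℤ) ∈ Set.Ico (0 : ℤ) (2 * D + 3) := ⟨by omega, by omega⟩
    have hl : (2 * D + 2 : ℤ) ∈ Set.Ico (0 : ℤ) (2 * D + 3) := ⟨by omega, by omega⟩
    refine ⟨fun z hz => ?_, ?_⟩
    · obtain ⟨r, hr, hrg, -⟩ := exists_common_of_diam_le (hrow z hz) (hrow z hz)
      refine ⟨?_, ?_, ?_⟩
      · obtain ⟨a, ha⟩ := (ih1 _ (hrg 0 h0)).1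
        exact ⟨a, 0, h0, r, hr, Or.inl hrg, ha⟩
      · rintro a ⟨i, hi, j, hj, hm, ha⟩
        refine (ih1 (subBlock D z (i, j)) ?_).2.1 a ha
        exact hm.elim (fun h => h i hi) (fun h => h j hj)
      · rintro a ⟨i, hi, j, hj, hm, ha⟩ b ⟨i', hi', j', hj', hm', hb⟩
        have l1 := toRow z hz r hr hrg 0 h0 i hi j hj hm
        have l2 := toRow z hz r hr hrg 0 h0 i' hi' j' hj' hm'
        exact ltrans _ _ _ (hrg 0 h0) l1 (lsymm _ _ l2) a ha b hb
    · rintro z z' hz hz' hadj a ⟨i, hi, j, hj, hm, ha⟩ b ⟨i', hi', j', hj', hm', hb⟩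
      rcases hadj with rfl | rfl
      -- Row `r` is good in both blocks; the last sub-block of this row in `z` is adjacent to the
      -- first one in `z'`.
      · obtain ⟨r, hr, hrg, hrg'⟩ := exists_common_of_diam_le (hrow z hz) (hrow _ hz')
        have l1 := toRow _ hz r hr hrg _ hl i hi j hj hm
        have l2 := toRow _ hz' r hr hrg' 0 h0 i' hi' j' hj' hm'
        have l3 := ih2 _ _ (hrg _ hl) (hrg' 0 h0) (Or.inl (by
          ext <;> simp [subBlock]; ring))
        exact ltrans _ _ _ (hrg' 0 h0) (ltrans _ _ _ (hrg _ hl) l1 l3) (lsymm _ _ l2) a ha b hb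
      · obtain ⟨r, hr, hrg, hrg'⟩ := exists_common_of_diam_le (hcol z hz) (hcol _ hz')
        have l1 := toCol _ hz r hr hrg _ hl i hi j hj hm
        have l2 := toCol _ hz' r hr hrg' 0 h0 i' hi' j' hj' hm'
        have l3 := ih2 _ _ (hrg _ hl) (hrg' 0 h0) (Or.inr (by
          ext <;> simp [subBlock]; ring))
        exact ltrans _ _ _ (hrg' 0 h0) (ltrans _ _ _ (hrg _ hl) l1 l3) (lsymm _ _ l2) a ha b hb

/-- The sites of the level-`k` block `z`. -/
def levelBlock (D k : ℕ) (z : ℤ × ℤ) : Set (ℤ × ℤ) :=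
  Set.Ico ((2 * D + 3 : ℤ) ^ k * z.1) ((2 * D + 3 : ℤ) ^ k * (z.1 + 1)) ×ˢ
    Set.Ico ((2 * D + 3 : ℤ) ^ k * z.2) ((2 * D + 3 : ℤ) ^ k * (z.2 + 1))

theorem finite_levelBlock (z : ℤ × ℤ) : (levelBlock D k z).Finite :=
  (Set.finite_Ico _ _).prod (Set.finite_Ico _ _)

theorem levelBlock_subBlock_subset {z u : ℤ × ℤ}
    (hu : u ∈ Set.Ico (0 : ℤ) (2 * D + 3) ×ˢ Set.Ico (0 : ℤ) (2 * D + 3)) :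
    levelBlock D k (subBlock D z u) ⊆ levelBlock D (k + 1) z := by
  obtain ⟨⟨h1, h2⟩, h3, h4⟩ := hu
  have hp : (0 : ℤ) < (2 * D + 3 : ℤ) ^ k := by positivity
  rintro a ⟨⟨a1, a2⟩, a3, a4⟩
  simp only [subBlock] at a1 a2 a3 a4
  refine ⟨⟨?_, ?_⟩, ?_, ?_⟩ <;> rw [pow_succ] <;> nlinarith

theorem mainPart_subset_levelBlock (k : ℕ) :
    ∀ z, mainPart D g k z ⊆ levelBlock D k z := by
  induction k with
  | zero => rintro z a rfl; simp [levelBlock]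
  | succ k ih =>
    rintro z a ⟨i, hi, j, hj, -, ha⟩
    exact levelBlock_subBlock_subset ⟨hi, hj⟩ (ih _ ha)

theorem good_congr {g' : ℤ × ℤ → Prop} (k : ℕ) :
    ∀ z, (∀ a ∈ levelBlock D k z, g a ↔ g' a) → (Good D g k z ↔ Good D g' k z) := by
  induction k with
  | zero => intro z h; exact h z (by simp [levelBlock])
  | succ k ih =>
    intro z h
    have h' : ∀ u ∈ Set.Ico (0 : ℤ) (2 * D + 3) ×ˢ Set.Ico (0 : ℤ) (2 * D + 3),
        (Good D g k (subBlock D z u) ↔ Good D g' k (subBlock D z u)) :=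
      fun u hu => ih _ fun a ha => h a (levelBlock_subBlock_subset hu ha)
    simp only [Good]
    refine forall₂_congr fun u hu => forall₂_congr fun u' hu' => ?_
    rw [h' u hu, h' u' hu']

/-- If all sub-blocks of the block at the origin are good at every level, then the component of the
origin is unbounded. -/
theorem exists_related_of_forall_good {R : ℤ × ℤ → ℤ × ℤ → Prop} (hsymm : ∀ a b, R a b → R b a)
    (htrans : ∀ a b c, R a b → R b c → R a c) (hrefl : ∀ a, g a → R a a)
    (hstep : ∀ a b, g a → g b → (b = (a.1 + 1, a.2) ∨ b = (a.1, a.2 + 1)) → R a b)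
    (h : ∀ k, ∀ u ∈ Set.Ico (0 : ℤ) (2 * D + 3) ×ˢ Set.Ico (0 : ℤ) (2 * D + 3), Good D g k u)
    (k : ℕ) : ∃ a, R 0 a ∧ g a ∧ (2 * D + 3 : ℤ) ^ k ≤ a.1 := by
  have h0 : (0 : ℤ) ∈ Set.Ico (0 : ℤ) (2 * D + 3) := ⟨by omega, by omega⟩
  have h1 : (1 : ℤ) ∈ Set.Ico (0 : ℤ) (2 * D + 3) := ⟨by omega, by omega⟩
  have hsub : ∀ u, subBlock D 0 u = u := fun u => by simp [subBlock]
  have hrow : ∀ k, RowGood D g k 0 0 := fun k i hi => by rw [hsub]; exact h k _ ⟨hi, h0⟩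
  -- The origin is the corner of its block at every level and row 0 is always good, so it never
  -- drops out of the main part. The block `(1, 0)` then supplies a related site far away.
  have hmem : ∀ k, (0 : ℤ × ℤ) ∈ mainPart D g k 0 := by
    intro k
    induction k with
    | zero => rfl
    | succ k ih => exact ⟨0, h0, 0, h0, Or.inl (hrow k), by rw [hsub]; exact ih⟩
  have hinv := good_mainPart (D := D) (g := g) hsymm htrans hrefl hstep
  obtain ⟨⟨a, ha⟩, hga, -⟩ := (hinv k).1 (1, 0) (h k _ ⟨h1, h0⟩)
  have ha' : a ∈ mainPart D g (k + 1) 0 :=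
    ⟨1, h1, 0, h0, Or.inl (hrow k), by rw [hsub]; exact ha⟩
  refine ⟨a, ((hinv (k + 1)).1 0 (h _ 0 ⟨h0, h0⟩)).2.2 0 (hmem _) a ha', hga a ha, ?_⟩
  have := (mainPart_subset_levelBlock k _ ha).1.1
  simpa using this

end Multiscale

end SitePercolation

namespace SitePercolation

/-! ### Probability estimates for bad blocks -/

section MultiscaleProbability

variable {d D : ℕ}

/-- The event that the level-`k` block `z` is bad. -/
def badEvent (D : ℕ) (G : ℤ × ℤ → Set (Config d)) (k : ℕ) (z : ℤ × ℤ) : Set (Config d) :=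
  {ω | ¬ Good D (fun a => ω ∈ G a) k z}

/-- The indices of the sub-blocks of a block. -/
noncomputable def subIndex (D : ℕ) : Finset (ℤ × ℤ) :=
  Finset.Ico (0 : ℤ) (2 * D + 3) ×ˢ Finset.Ico (0 : ℤ) (2 * D + 3)

theorem mem_subIndex {u : ℤ × ℤ} :
    u ∈ subIndex D ↔ u ∈ Set.Ico (0 : ℤ) (2 * D + 3) ×ˢ Set.Ico (0 : ℤ) (2 * D + 3) := by
  simp [subIndex]

theorem card_subIndex : (subIndex D).card = (2 * D + 3) ^ 2 := by
  rw [subIndex, Finset.card_product, Int.card_Ico, sq]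
  congr 1

variable {G : ℤ × ℤ → Set (Config d)} {V : ℤ × ℤ → Set (Fin d → ℤ)}

theorem localOn_badEvent (hG : ∀ a, LocalOn (V a) (G a)) (k : ℕ) (z : ℤ × ℤ) :
    LocalOn (⋃ a ∈ levelBlock D k z, V a) (badEvent D G k z) := by
  intro ω ω' hω h h'
  refine h ((good_congr k z fun a ha => ?_).1 h')
  have hz : ∀ x ∈ V a, ω x = ω' x := fun x hx => hω x (Set.mem_biUnion ha hx)
  exact ⟨hG a fun x hx => (hz x hx).symm, hG a hz⟩

/-- At least `D` whole blocks, each of side at least 1, separate the two. Hence the same `D` ensures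
independence at every level. -/
theorem lt_abs_sub_of_levelBlock {k : ℕ} {x y a b : ℤ} (h : (D : ℤ) < |x - y|)
    (ha : a ∈ Set.Ico ((2 * D + 3 : ℤ) ^ k * x) ((2 * D + 3 : ℤ) ^ k * (x + 1)))
    (hb : b ∈ Set.Ico ((2 * D + 3 : ℤ) ^ k * y) ((2 * D + 3 : ℤ) ^ k * (y + 1))) :
    (D : ℤ) < |a - b| := by
  obtain ⟨a1, a2⟩ := ha
  obtain ⟨b1, b2⟩ := hb
  have hp : (1 : ℤ) ≤ (2 * D + 3 : ℤ) ^ k := one_le_pow₀ (by omega)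
  set q := (2 * D + 3 : ℤ) ^ k
  have hD : (0 : ℤ) ≤ D := by omega
  rw [lt_abs] at h ⊢
  rcases h with h | h
  · left
    have : q * (y + 1 + D) ≤ q * x := mul_le_mul_of_nonneg_left (by omega) (by omega)
    nlinarith
  · right
    have : q * (x + 1 + D) ≤ q * y := mul_le_mul_of_nonneg_left (by omega) (by omega)
    nlinarith

/-- A bad block contains two bad sub-blocks more than `D` apart, which are independent. The union
bound over `(2D+3)^4` ordered pairs gives `ε_{k+1} ≤ (2D+3)^4 ε_k²`, where the small prefactor
provides the halving. -/
theorem real_badEvent_le (p : unitInterval) {ε : ℝ} (hV : ∀ a, (V a).Finite)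
    (hG : ∀ a, LocalOn (V a) (G a))
    (hdisj : ∀ a b : ℤ × ℤ, ((D : ℤ) < |a.1 - b.1| ∨ (D : ℤ) < |a.2 - b.2|) →
      Disjoint (V a) (V b))
    (hε : ∀ a, (P d p).real (G a)ᶜ ≤ ε) (hsmall : (2 * D + 3 : ℝ) ^ 4 * ε ≤ 1 / 2) (k : ℕ) :
    ∀ z, (P d p).real (badEvent D G k z) ≤ ε * (1 / 2) ^ k := by
  have hε0 : 0 ≤ ε := measureReal_nonneg.trans (hε 0)
  induction k with
  | zero =>
    intro z
    rw [pow_zero, mul_one]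
    exact hε z
  | succ k ih =>
    intro z
    have hfin : ∀ z, (⋃ a ∈ levelBlock D k z, V a).Finite := fun z =>
      (finite_levelBlock z).biUnion fun a _ => hV a
    have hsub : badEvent D G (k + 1) z ⊆ ⋃ u ∈ subIndex D, ⋃ u' ∈ subIndex D,
        {ω | ((D : ℤ) < |u.1 - u'.1| ∨ (D : ℤ) < |u.2 - u'.2|) ∧
          ω ∈ badEvent D G k (subBlock D z u) ∩ badEvent D G k (subBlock D z u')} := by
      intro ω hω
      simp only [badEvent, Good, Set.mem_ofPred_eq, not_forall] at hω
      obtain ⟨u, hu, u', hu', hb, hb', hfar⟩ := hω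
      refine Set.mem_biUnion (mem_subIndex.2 hu) (Set.mem_biUnion (mem_subIndex.2 hu')
        ⟨?_, hb, hb'⟩)
      by_contra! hcon
      exact hfar hcon
    have hpair : ∀ u u', (P d p).real {ω | ((D : ℤ) < |u.1 - u'.1| ∨ (D : ℤ) < |u.2 - u'.2|) ∧
          ω ∈ badEvent D G k (subBlock D z u) ∩ badEvent D G k (subBlock D z u')} ≤
        (ε * (1 / 2) ^ k) ^ 2 := by
      intro u u'
      by_cases hfar : (D : ℤ) < |u.1 - u'.1| ∨ (D : ℤ) < |u.2 - u'.2|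
      · simp only [hfar, true_and, Set.ofPred_mem_eq]
        rw [LocalOn.real_inter_eq_mul (hfin _) (hfin _) ?_ (localOn_badEvent hG k _)
          (localOn_badEvent hG k _), sq]
        · exact mul_le_mul (ih _) (ih _) measureReal_nonneg (by positivity)
        · simp only [Set.disjoint_iUnion_left, Set.disjoint_iUnion_right]
          intro b hb a ha
          refine hdisj _ _ (hfar.imp (fun h => ?_) fun h => ?_)
          · exact lt_abs_sub_of_levelBlock (by simpa [subBlock] using h) ha.1 hb.1
          · exact lt_abs_sub_of_levelBlock (by simpa [subBlock] using h) ha.2 hb.2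
      · simp only [hfar, false_and, Set.ofPred_false, measureReal_empty]
        positivity
    calc (P d p).real (badEvent D G (k + 1) z)
        ≤ _ := measureReal_mono hsub (measure_ne_top _ _)
      _ ≤ _ := measureReal_biUnion_finset_le _ _
      _ ≤ ∑ u ∈ subIndex D, ∑ u' ∈ subIndex D, (ε * (1 / 2) ^ k) ^ 2 :=
        Finset.sum_le_sum fun u _ => (measureReal_biUnion_finset_le _ _).trans
          (Finset.sum_le_sum fun u' _ => hpair u u')
      _ = ((2 * D + 3 : ℝ) ^ 4 * ε) * (1 / 2) ^ k * (ε * (1 / 2) ^ k) := by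
        simp only [Finset.sum_const, card_subIndex, nsmul_eq_mul]
        push_cast
        ring
      _ ≤ (1 / 2) * 1 * (ε * (1 / 2) ^ k) := by
        gcongr
        exact pow_le_one₀ (by norm_num) (by norm_num)
      _ = _ := by ring

/-- If bad blocks are rare, then with positive probability all blocks near the origin are good. -/
theorem real_exists_bad_lt_one (p : unitInterval) {ε : ℝ} (hV : ∀ a, (V a).Finite)
    (hG : ∀ a, LocalOn (V a) (G a))
    (hdisj : ∀ a b : ℤ × ℤ, ((D : ℤ) < |a.1 - b.1| ∨ (D : ℤ) < |a.2 - b.2|) →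
      Disjoint (V a) (V b))
    (hε : ∀ a, (P d p).real (G a)ᶜ ≤ ε) (hsmall : (2 * D + 3 : ℝ) ^ 4 * ε ≤ 1 / 4) :
    (P d p).real {ω | ∃ k, ∃ u ∈ subIndex D, ω ∈ badEvent D G k u} < 1 := by
  have hε0 : 0 ≤ ε := measureReal_nonneg.trans (hε 0)
  have hb := real_badEvent_le p hV hG hdisj hε (by linarith)
  set c : ℝ := (2 * D + 3 : ℝ) ^ 2 * ε with hc
  have hc0 : 0 ≤ c := by positivity
  have hc1 : c * 2 < 1 := by
    have h9 : (9 : ℝ) ≤ (2 * D + 3 : ℝ) ^ 2 := by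
      have : (0 : ℝ) ≤ D := Nat.cast_nonneg D
      nlinarith
    have : (2 * D + 3 : ℝ) ^ 4 * ε = (2 * D + 3 : ℝ) ^ 2 * c := by rw [hc]; ring
    nlinarith
  have hlevel : ∀ k, P d p (⋃ u ∈ subIndex D, badEvent D G k u) ≤
      ENNReal.ofReal (c * (1 / 2) ^ k) := by
    intro k
    rw [← ofReal_measureReal (measure_ne_top _ _)]
    refine ENNReal.ofReal_le_ofReal ((measureReal_biUnion_finset_le _ _).trans
      ((Finset.sum_le_sum fun u _ => hb k u).trans (le_of_eq ?_)))
    rw [Finset.sum_const, card_subIndex, nsmul_eq_mul, hc]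
    push_cast
    ring
  have hset : {ω | ∃ k, ∃ u ∈ subIndex D, ω ∈ badEvent D G k u} =
      ⋃ k, ⋃ u ∈ subIndex D, badEvent D G k u := by
    ext ω; simp
  have hsum : HasSum (fun k : ℕ => c * (1 / 2) ^ k) (c * 2) :=
    hasSum_geometric_two.mul_left c
  have hle : P d p (⋃ k, ⋃ u ∈ subIndex D, badEvent D G k u) ≤ ENNReal.ofReal (c * 2) := by
    refine (measure_iUnion_le _).trans ((ENNReal.tsum_le_tsum hlevel).trans (le_of_eq ?_))
    rw [← ENNReal.ofReal_tsum_of_nonneg (fun k => by positivity) hsum.summable, hsum.tsum_eq]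
  rw [hset, measureReal_def]
  exact (ENNReal.toReal_le_of_le_ofReal (by positivity) hle).trans_lt hc1

end MultiscaleProbability

end SitePercolation

namespace SitePercolation

/-! ### Second criterion: likely, essentially unique crossings at one scale imply percolation -/

section Supercritical

variable {d : ℕ}

theorem clusterIn_congr {W : Set (Fin d → ℤ)} {ω ω' : Config d} (h : ∀ z ∈ W, ω z = ω' z)
    (x : Fin d → ℤ) : clusterIn ω W x = clusterIn ω' W x := by
  ext y
  exact ⟨fun hy => localOn_connectedIn W x y h hy,
    fun hy => localOn_connectedIn W x y (fun z hz => (h z hz).symm) hy⟩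

theorem localOn_twoArmEvent (m n : ℕ) : LocalOn (box d n) (twoArmEvent d m n) := by
  have key : ∀ {ω ω' : Config d} {C : Set (Fin d → ℤ)}, (∀ z ∈ box d n, ω z = ω' z) →
      IsOpenCluster ω (box d n) C → IsOpenCluster ω' (box d n) C := by
    rintro ω ω' C h ⟨x, hx, hxω, rfl⟩
    exact ⟨x, hx, (h x hx).symm.trans hxω, clusterIn_congr h x⟩
  rintro ω ω' h ⟨C, C', hC, hC', hrest⟩
  exact ⟨C, C', key h hC, key h hC', hrest⟩

theorem exists_connectedIn_boxBoundary {ω : Config d} {n : ℕ} {W : Set (Fin d → ℤ)}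
    {x y : Fin d → ℤ} (hx : x ∈ box d n) (hy : y ∉ box d n) (h : ConnectedIn ω W x y) :
    ∃ u ∈ boxBoundary d n, ConnectedIn ω (W ∩ box d n) x u := by
  obtain ⟨u, v, hu, hv, huv, hj, -⟩ := Joined.first_exit h hx hy
  exact ⟨u, mem_boxBoundary_of_adj huv hu hv, hj.mono fun z hz => ⟨hz.1.1, hz.1.2, hz.2⟩⟩

theorem mem_twoArmEvent {ω : Config d} {m n : ℕ} {a b u v : Fin d → ℤ}
    (ha : a ∈ box d m) (hb : b ∈ box d m) (hu : u ∈ boxBoundary d n) (hv : v ∈ boxBoundary d n)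
    (hau : ConnectedIn ω (box d n) a u) (hbv : ConnectedIn ω (box d n) b v)
    (hab : ¬ ConnectedIn ω (box d n) a b) : ω ∈ twoArmEvent d m n := by
  have ha' := Joined.left_mem hau
  have hb' := Joined.left_mem hbv
  refine ⟨clusterIn ω (box d n) a, clusterIn ω (box d n) b, ⟨a, ha'.2, ha'.1, rfl⟩,
    ⟨b, hb'.2, hb'.1, rfl⟩, fun h => hab ?_, ⟨a, Joined.refl ha', ha⟩, ⟨u, hau, hu⟩,
    ⟨b, Joined.refl hb', hb⟩, ⟨v, hbv, hv⟩⟩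
  have : b ∈ clusterIn ω (box d n) b := Joined.refl hb'
  rwa [← h] at this

theorem connectedIn_of_notMem_twoArmEvent {ω : Config d} {m n : ℕ} (hmn : m ≤ n)
    (hω : ω ∉ twoArmEvent d m n) {a b y y' : Fin d → ℤ}
    (ha : a ∈ box d m) (hb : b ∈ box d m) (hy : y ∉ box d n) (hy' : y' ∉ box d n)
    (hay : ConnectedIn ω Set.univ a y) (hby : ConnectedIn ω Set.univ b y') :
    ConnectedIn ω (box d n) a b := by
  obtain ⟨u, hu, hau⟩ := exists_connectedIn_boxBoundary (box_mono hmn ha) hy hay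
  obtain ⟨v, hv, hbv⟩ := exists_connectedIn_boxBoundary (box_mono hmn hb) hy' hby
  rw [Set.univ_inter] at hau hbv
  by_contra hab
  exact hω (mem_twoArmEvent ha hb hu hv hau hbv hab)

/-- The centre of the block with coarse coordinates `z` in a coordinate plane. -/
def blockCentre (d m : ℕ) (z : ℤ × ℤ) : Fin d → ℤ :=
  fun i => if i.val = 0 then m * z.1 else if i.val = 1 then m * z.2 else 0

/-- The block with coarse coordinates `z` is crossed by an essentially unique open cluster. -/
def uniqueCrossing (d M m : ℕ) (z : ℤ × ℤ) : Set (Config d) :=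
  {ω | ω ∘ Equiv.addRight (blockCentre d m z) ∈
    armEvent d m ((2 * M + 1) * m) ∩ (twoArmEvent d (2 * m) (M * (2 * m)))ᶜ}

theorem LocalOn.shift {n : ℕ} {E : Set (Config d)} (h : LocalOn (box d n) E) (c : Fin d → ℤ) :
    LocalOn (boxAt c n) {ω | ω ∘ Equiv.addRight c ∈ E} :=
  fun _ _ hω hE => h (fun z hz => hω (z + c) (by simpa [boxAt] using hz)) hE

theorem localOn_uniqueCrossing (M m : ℕ) (z : ℤ × ℤ) :
    LocalOn (boxAt (blockCentre d m z) ((2 * M + 1) * m + 1)) (uniqueCrossing d M m z) :=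
  (((localOn_armEvent _ _).inter ((localOn_twoArmEvent _ _).compl.mono
    (box_mono (by nlinarith)))).shift _)

theorem abs_sub_le_of_mem_boxAt {c z : Fin d → ℤ} {n : ℕ} (h : z ∈ boxAt c n) (i : Fin d) :
    |z i - c i| ≤ n := mem_box.1 h i

/-- Boxes of radius `(2M+1)m+1` that meet have centres at most `2(2M+1)m + 2 ≤ (4M+4)m` apart in
each coordinate. The assumption `2 ≤ d` provides the two coordinates of the plane. -/
theorem disjoint_boxAt_blockCentre (hd : 2 ≤ d) {M m : ℕ} (hm : 0 < m) {a b : ℤ × ℤ}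
    (h : ((4 * M + 4 : ℕ) : ℤ) < |a.1 - b.1| ∨ ((4 * M + 4 : ℕ) : ℤ) < |a.2 - b.2|) :
    Disjoint (boxAt (blockCentre d m a) ((2 * M + 1) * m + 1))
      (boxAt (blockCentre d m b) ((2 * M + 1) * m + 1)) := by
  have hm' : (1 : ℤ) ≤ m := by exact_mod_cast hm
  have key : ∀ x s t : ℤ, |x - m * s| ≤ (((2 * M + 1) * m + 1 : ℕ) : ℤ) →
      |x - m * t| ≤ (((2 * M + 1) * m + 1 : ℕ) : ℤ) → ¬ ((4 * M + 4 : ℕ) : ℤ) < |s - t| := by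
    intro x s t hs ht hst
    have h1 : |(m : ℤ) * (s - t)| ≤ 2 * ((2 * M + 1) * m + 1) := by
      have : (m : ℤ) * (s - t) = (x - m * t) - (x - m * s) := by ring
      rw [this]
      refine (abs_sub _ _).trans ?_
      push_cast at hs ht
      linarith
    rw [abs_mul, Nat.abs_cast] at h1
    push_cast at hst
    nlinarith [mul_le_mul_of_nonneg_left (show (4 * M + 5 : ℤ) ≤ |s - t| by omega)
      (show (0 : ℤ) ≤ m by omega)]
  rw [Set.disjoint_left]
  intro x hxa hxb
  rcases h with h | h
  · have h1 := abs_sub_le_of_mem_boxAt hxa ⟨0, by omega⟩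
    have h2 := abs_sub_le_of_mem_boxAt hxb ⟨0, by omega⟩
    simp only [blockCentre, if_true] at h1 h2
    exact key _ _ _ h1 h2 h
  · have h1 := abs_sub_le_of_mem_boxAt hxa ⟨1, by omega⟩
    have h2 := abs_sub_le_of_mem_boxAt hxb ⟨1, by omega⟩
    simp only [blockCentre, one_ne_zero, if_false, if_true] at h1 h2
    exact key _ _ _ h1 h2 h

theorem exists_of_mem_uniqueCrossing {ω : Config d} {M m : ℕ} {z : ℤ × ℤ}
    (h : ω ∈ uniqueCrossing d M m z) :
    ∃ v, v - blockCentre d m z ∈ box d m ∧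
      ∃ y, y - blockCentre d m z ∉ box d ((2 * M + 1) * m) ∧ ConnectedIn ω Set.univ v y := by
  obtain ⟨x, y, ⟨hx, hy⟩, hxy⟩ := h.1
  rw [sub_zero] at hx hy
  exact ⟨x + blockCentre d m z, by simpa using hx, y + blockCentre d m z, by simpa using hy,
    hxy.shift fun _ _ => trivial⟩

/-- The radii are chosen for this: a neighbour's box of radius `m` lies in the box of radius `2m`
around the present centre, and leaving radius `(2M+1)m = 2Mm + m` around the neighbour means leaving
radius `2Mm` here. So the absence of two arms at `a` identifies the two clusters. -/
theorem connectedIn_of_adjacent_uniqueCrossing {ω : Config d} {M m : ℕ} (hM : 1 ≤ M) {a b : ℤ × ℤ}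
    (ha : ω ∈ uniqueCrossing d M m a) (hab : b = (a.1 + 1, a.2) ∨ b = (a.1, a.2 + 1))
    {v y v' y' : Fin d → ℤ} (hv : v - blockCentre d m a ∈ box d m)
    (hy : y - blockCentre d m a ∉ box d ((2 * M + 1) * m)) (hvy : ConnectedIn ω Set.univ v y)
    (hv' : v' - blockCentre d m b ∈ box d m)
    (hy' : y' - blockCentre d m b ∉ box d ((2 * M + 1) * m))
    (hvy' : ConnectedIn ω Set.univ v' y') : ConnectedIn ω Set.univ v v' := by
  have hcentre : ∀ i, |blockCentre d m b i - blockCentre d m a i| ≤ m := by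
    intro i
    rcases hab with rfl | rfl <;> simp only [blockCentre] <;> split_ifs <;>
      simp [mul_add]
  have h1 : v' - blockCentre d m a ∈ box d (2 * m) := mem_box.2 fun i => by
    have h2 := abs_le.1 (mem_box.1 hv' i)
    have h3 := abs_le.1 (hcentre i)
    simp only [Pi.sub_apply] at h2 ⊢
    rw [abs_le]
    push_cast
    constructor <;> linarith
  have h2 : y - blockCentre d m a ∉ box d (M * (2 * m)) :=
    fun h => hy (box_mono (by nlinarith) h)
  have h3 : y' - blockCentre d m a ∉ box d (M * (2 * m)) := by
    refine fun h => hy' (mem_box.2 fun i => ?_)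
    have h2 := abs_le.1 (mem_box.1 h i)
    have h3 := abs_le.1 (hcentre i)
    simp only [Pi.sub_apply] at h2 ⊢
    rw [abs_le]
    push_cast at *
    constructor <;> linarith
  have hu := connectedIn_of_notMem_twoArmEvent (by nlinarith) ha.2
    (box_mono (by omega) hv) h1 h2 h3 (hvy.shift_neg fun _ _ => trivial)
    (hvy'.shift_neg fun _ _ => trivial)
  have := hu.shift (W' := Set.univ) fun _ _ => trivial
  simpa using this

theorem exists_infinite_cluster (hd : 2 ≤ d) {ω : Config d} {M m D : ℕ} (hM : 1 ≤ M) (hm : 0 < m)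
    (h : ∀ k, ∀ u ∈ subIndex D, ω ∉ badEvent D (uniqueCrossing d M m) k u) :
    ∃ x ∈ box d m, (clusterIn ω Set.univ x).Infinite := by
  classical
  choose! v hv y hy hvy using fun z (hz : ω ∈ uniqueCrossing d M m z) =>
    exists_of_mem_uniqueCrossing hz
  have hrel := exists_related_of_forall_good (D := D) (g := fun a => ω ∈ uniqueCrossing d M m a)
    (R := fun a b => ConnectedIn ω Set.univ (v a) (v b)) (fun a b h => Joined.symm h)
    (fun a b c h h' => Joined.trans h h') (fun a ha => Joined.refl (Joined.left_mem (hvy a ha)))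
    (fun a b ha hb hab => connectedIn_of_adjacent_uniqueCrossing hM ha hab (hv a ha) (hy a ha)
      (hvy a ha) (hv b hb) (hy b hb) (hvy b hb))
    (fun k u hu => by
      have := h k u (mem_subIndex.2 hu)
      rwa [badEvent, Set.mem_ofPred_eq, not_not] at this)
  have h0 : ω ∈ uniqueCrossing d M m 0 := by
    have := h 0 0 (by simp [subIndex]; omega)
    rwa [badEvent, Set.mem_ofPred_eq, not_not] at this
  have hm' : (1 : ℤ) ≤ m := by exact_mod_cast hm
  refine ⟨v 0, ?_, fun hfin => ?_⟩
  · have : blockCentre d m 0 = 0 := by ext i; simp [blockCentre]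
    simpa [this] using hv 0 h0
  -- A finite cluster has bounded first coordinate, but the block with first index at least
  -- `(2D+3)^k`, `k = (B+m).toNat`, contributes a site beyond `B`.
  · obtain ⟨B, hB⟩ := (hfin.image fun x => x ⟨0, by omega⟩).bddAbove
    obtain ⟨a, hR, ha, hk⟩ := hrel (B + m).toNat
    have h1 : v a ⟨0, by omega⟩ ≤ B := hB ⟨v a, hR, rfl⟩
    have h2 := abs_le.1 (mem_box.1 (hv a ha) ⟨0, by omega⟩)
    simp only [Pi.sub_apply, blockCentre, if_true] at h2
    have h3 : B + m < (2 * D + 3 : ℤ) ^ (B + m).toNat := by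
      have h4 : (B + m).toNat < (2 * D + 3) ^ (B + m).toNat := Nat.lt_pow_self (by omega)
      have h5 : (((B + m).toNat : ℕ) : ℤ) < (2 * D + 3 : ℤ) ^ (B + m).toNat := by
        exact_mod_cast h4
      have := Int.self_le_toNat (B + m)
      omega
    have hpos : (0 : ℤ) < (2 * D + 3 : ℤ) ^ (B + m).toNat := by positivity
    nlinarith

theorem theta_pos_of_exists_infinite_cluster (p : unitInterval) {m : ℕ}
    (h : 0 < (P d p).real {ω | ∃ x ∈ box d m, (clusterIn ω Set.univ x).Infinite}) :
    0 < theta d p := by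
  have hshift : ∀ x, (P d p).real {ω | (clusterIn ω Set.univ x).Infinite} ≤ theta d p := by
    intro x
    rw [theta, ← real_preimage_comp_equiv p (Equiv.addRight x)
      {ω | (clusterIn ω Set.univ 0).Infinite}]
    refine measureReal_mono fun ω hω => ?_
    refine (Set.Infinite.image (f := fun y => y - x) sub_left_injective.injOn hω).mono ?_
    rintro _ ⟨y, hy, rfl⟩
    have h1 : ConnectedIn ω Set.univ x y := hy
    have := h1.shift_neg (W' := Set.univ) (a := x) fun _ _ => trivial
    rwa [sub_self] at this
  have hsub : {ω : Config d | ∃ x ∈ box d m, (clusterIn ω Set.univ x).Infinite} ⊆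
      ⋃ x ∈ (finite_box (d := d) m).toFinset, {ω | (clusterIn ω Set.univ x).Infinite} := by
    rintro ω ⟨x, hx, hω⟩
    exact Set.mem_biUnion (Set.Finite.mem_toFinset _ |>.2 hx) hω
  have hle := (measureReal_mono hsub (measure_ne_top (P d p) _)).trans
    ((measureReal_biUnion_finset_le _ _).trans (Finset.sum_le_sum fun x _ => hshift x))
  rw [Finset.sum_const, nsmul_eq_mul] at hle
  by_contra hθ
  have : theta d p ≤ 0 := not_lt.1 hθ
  have := mul_nonpos_of_nonneg_of_nonpos
    (Nat.cast_nonneg (α := ℝ) (finite_box (d := d) m).toFinset.card) this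
  linarith

/-- A finite-size criterion for percolation: if at one scale crossing clusters exist and are unique
with high probability, then there is an infinite open cluster. -/
theorem theta_pos_of_unique_crossing (hd : 2 ≤ d) (p : unitInterval) {M m : ℕ} (hM : 1 ≤ M)
    (hm : 0 < m)
    (h : (8 * M + 11 : ℝ) ^ 4 * ((1 - (P d p).real (armEvent d m ((2 * M + 1) * m))) +
      (P d p).real (twoArmEvent d (2 * m) (M * (2 * m)))) ≤ 1 / 4) :
    0 < theta d p := by
  have marm := (localOn_armEvent (d := d) m ((2 * M + 1) * m)).measurableSet (finite_box _)
  have hbad : ∀ a, (P d p).real (uniqueCrossing d M m a)ᶜ ≤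
      (1 - (P d p).real (armEvent d m ((2 * M + 1) * m))) +
      (P d p).real (twoArmEvent d (2 * m) (M * (2 * m))) := by
    intro a
    have e1 := real_preimage_comp_equiv p (Equiv.addRight (blockCentre d m a))
      (armEvent d m ((2 * M + 1) * m) ∩ (twoArmEvent d (2 * m) (M * (2 * m)))ᶜ)ᶜ
    have e2 : (uniqueCrossing d M m a)ᶜ = {ω | ω ∘ Equiv.addRight (blockCentre d m a) ∈
      (armEvent d m ((2 * M + 1) * m) ∩ (twoArmEvent d (2 * m) (M * (2 * m)))ᶜ)ᶜ} := rfl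
    rw [e2, e1, Set.compl_inter, compl_compl, ← probReal_compl_eq_one_sub marm]
    exact measureReal_union_le _ _
  -- With this `D`, `2D + 3 = 8M + 11`, the constant of the hypothesis.
  have hlt := real_exists_bad_lt_one (D := 4 * M + 4) p
    (fun a => finite_boxAt (blockCentre d m a) _)
    (fun a => localOn_uniqueCrossing M m a)
    (fun a b hab => disjoint_boxAt_blockCentre hd hm hab) hbad (by
      push_cast; convert h using 3; ring)
  refine theta_pos_of_exists_infinite_cluster p (m := m) ?_
  -- Subadditivity over a cover, rather than taking a complement, needs no measurability of either
  -- event.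
  have hcov : (Set.univ : Set (Config d)) ⊆
      {ω | ∃ k, ∃ u ∈ subIndex (4 * M + 4),
        ω ∈ badEvent (4 * M + 4) (uniqueCrossing d M m) k u} ∪
      {ω | ∃ x ∈ box d m, (clusterIn ω Set.univ x).Infinite} := by
    intro ω _
    by_cases hω : ∃ k, ∃ u ∈ subIndex (4 * M + 4),
        ω ∈ badEvent (4 * M + 4) (uniqueCrossing d M m) k u
    · exact Or.inl hω
    · push Not at hω
      exact Or.inr (exists_infinite_cluster hd hM hm hω)
  have h1 := (measureReal_mono hcov (measure_ne_top (P d p) _)).trans (measureReal_union_le _ _)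
  rw [probReal_univ] at h1
  linarith

end Supercritical

end SitePercolation

namespace SitePercolation

/-! ### Arms in half spaces separated by an uncrossed slab -/

section HalfSpaces

variable {d : ℕ}

/-- In the part of `Λ(N)` where the `i`-th coordinate is at most `-n`, an open path connects `Λ(n)`
with `∂Λ(N)`. -/
def lowerArm (i : Fin d) (n N : ℕ) : Set (Config d) :=
  linkEvent ({z | z i ≤ -(n : ℤ)} ∩ box d N) fun x y => x ∈ box d n ∧ y ∈ boxBoundary d N

/-- In the part of `Λ(N)` where the `i`-th coordinate is at least `n`, an open path connects `Λ(n)`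
with `∂Λ(N)`. -/
def upperArm (i : Fin d) (n N : ℕ) : Set (Config d) :=
  linkEvent ({z | (n : ℤ) ≤ z i} ∩ box d N) fun x y => x ∈ box d n ∧ y ∈ boxBoundary d N

/-- The sites of `Λ(N)` whose `i`-th coordinate is strictly between `-n` and `n`. -/
def slab (i : Fin d) (n N : ℕ) : Set (Fin d → ℤ) := {z | -(n : ℤ) < z i ∧ z i < n} ∩ box d N

/-- An open path crosses the slab in the `i`-th direction. -/
def slabCrossing (i : Fin d) (n N : ℕ) : Set (Config d) :=
  linkEvent (slab i n N) fun x y => x i = -(n : ℤ) + 1 ∧ y i = n - 1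

theorem finite_slab (i : Fin d) (n N : ℕ) : (slab i n N).Finite :=
  (finite_box N).subset Set.inter_subset_right

theorem neg_mem_box {n : ℕ} {x : Fin d → ℤ} (h : x ∈ box d n) : -x ∈ box d n :=
  mem_box.2 fun i => by simpa using mem_box.1 h i

theorem neg_mem_boxBoundary {n : ℕ} {x : Fin d → ℤ} (h : x ∈ boxBoundary d n) :
    -x ∈ boxBoundary d n :=
  ⟨neg_mem_box h.1, by rw [norm_neg]; exact h.2⟩

theorem real_lowerArm_le_upperArm (p : unitInterval) (i : Fin d) (n N : ℕ) :
    (P d p).real (lowerArm i n N) ≤ (P d p).real (upperArm i n N) := by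
  rw [← real_preimage_comp_equiv p (Equiv.neg _) (lowerArm i n N)]
  refine measureReal_mono ?_
  rintro ω ⟨x, y, ⟨hx, hy⟩, hxy⟩
  refine ⟨-x, -y, ⟨neg_mem_box hx, neg_mem_boxBoundary hy⟩, hxy.neg fun z hz => ⟨?_, ?_⟩⟩
  · have : z i ≤ -(n : ℤ) := hz.1
    change (n : ℤ) ≤ -z i
    omega
  · exact neg_mem_box hz.2

/-- A path joining the two arms inside `Λ(N)`, taken from its last visit to `z i ≤ -n` until it next
reaches `z i ≥ n`, crosses the slab. -/
theorem arms_inter_subset_twoArmEvent (i : Fin d) {n N : ℕ} (hn : 0 < n) :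
    lowerArm i n N ∩ (upperArm i n N ∩ (slabCrossing i n N)ᶜ) ⊆ twoArmEvent d n N := by
  rintro ω ⟨⟨a, u, ⟨ha, hu⟩, hau⟩, ⟨b, v, ⟨hb, hv⟩, hbv⟩, hns⟩
  refine mem_twoArmEvent ha hb hu hv (hau.mono Set.inter_subset_right)
    (hbv.mono Set.inter_subset_right) fun hab => hns ?_
  have hai : a i ≤ -(n : ℤ) := (Joined.left_mem hau).2.1
  have hbi : (n : ℤ) ≤ b i := (Joined.left_mem hbv).2.1
  obtain ⟨s, t, hs, ht, hst, -, hj⟩ := Joined.last_exit (A := {z | z i ≤ -(n : ℤ)}) hab hai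
    (by simp only [Set.mem_ofPred_eq]; omega)
  have hst' := abs_le.1 (abs_sub_le_one_of_adj hst i)
  simp only [Set.mem_ofPred_eq] at hs ht
  obtain ⟨s', t', hs', ht', hst2, hj', -⟩ := Joined.first_exit (A := {z | z i < (n : ℤ)}) hj
    (by simp only [Set.mem_ofPred_eq]; omega) (by simp only [Set.mem_ofPred_eq]; omega)
  have hst2' := abs_le.1 (abs_sub_le_one_of_adj hst2 i)
  simp only [Set.mem_ofPred_eq] at hs' ht'
  refine ⟨t, s', ⟨by omega, by omega⟩, Joined.mono hj' ?_⟩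
  rintro z ⟨⟨⟨hz1, hz2⟩, hz3⟩, hz4⟩
  simp only [Set.mem_ofPred_eq] at hz3 hz4
  exact ⟨hz1, ⟨by omega, hz4⟩, hz2⟩

theorem mul_le_real_twoArmEvent (p : unitInterval) (i : Fin d) {n N : ℕ} (hn : 0 < n) :
    (P d p).real (lowerArm i n N) ^ 2 * (P d p).real (slabCrossing i n N)ᶜ ≤
      (P d p).real (twoArmEvent d n N) := by
  refine le_trans ?_ (measureReal_mono (arms_inter_subset_twoArmEvent i hn))
  have hfl : ({z : Fin d → ℤ | z i ≤ -(n : ℤ)} ∩ box d N).Finite :=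
    (finite_box N).subset Set.inter_subset_right
  have hfu : ({z : Fin d → ℤ | (n : ℤ) ≤ z i} ∩ box d N).Finite :=
    (finite_box N).subset Set.inter_subset_right
  have hu : LocalOn ({z | (n : ℤ) ≤ z i} ∩ box d N) (upperArm i n N) := localOn_linkEvent _ _
  have hl : LocalOn ({z | z i ≤ -(n : ℤ)} ∩ box d N) (lowerArm i n N) := localOn_linkEvent _ _
  have hs : LocalOn (slab i n N) (slabCrossing i n N)ᶜ := (localOn_linkEvent _ _).compl
  rw [LocalOn.real_inter_eq_mul hfl (hfu.union (finite_slab i n N)) ?_ hl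
    ((hu.mono Set.subset_union_left).inter (hs.mono Set.subset_union_right)),
    LocalOn.real_inter_eq_mul hfu (finite_slab i n N) ?_ hu hs, sq, mul_assoc]
  · exact mul_le_mul_of_nonneg_left (mul_le_mul_of_nonneg_right
      (real_lowerArm_le_upperArm p i n N) measureReal_nonneg) measureReal_nonneg
  · rw [Set.disjoint_left]
    rintro z ⟨hz, -⟩ ⟨⟨-, hz'⟩, -⟩
    simp only [Set.mem_ofPred_eq] at hz
    omega
  · rw [Set.disjoint_left]
    rintro z ⟨hz, -⟩ (⟨hz', -⟩ | ⟨⟨hz', -⟩, -⟩) <;> simp only [Set.mem_ofPred_eq] at hz hz' <;> omega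

/-- The event that `Λ(s)` is connected to `{z | z i < -2s}`. -/
def directedArm (i : Fin d) (s : ℕ) : Set (Config d) :=
  linkEvent (box d (2 * s + 1)) fun x y => x ∈ box d s ∧ y i < -(2 * s : ℤ)

/-- After its last exit from `{z i ≥ -s}`, where `s = Mn`, the path stays in a half space.
Translating this half space to `{z i ≤ -n}` puts the starting point in `Λ(n)`, once its other
coordinates are rounded to multiples of `n`, and leaves the endpoint outside `Λ(s)`. -/
theorem directedArm_subset (i : Fin d) {M n : ℕ} (hM : 1 ≤ M) (hn : 0 < n) :
    directedArm i (M * n) ⊆ ⋃ w ∈ boxIndex d (2 * M + 1),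
      {ω | ω ∘ Equiv.addRight (Function.update ((n : ℤ) • w) i (n - (M * n : ℕ) - 1)) ∈
        lowerArm i n (M * n)} := by
  rintro ω ⟨x, y, ⟨hx, hy⟩, hxy⟩
  set s := M * n with hs
  have hns : n ≤ s := Nat.le_mul_of_pos_left n hM
  have hxi := abs_le.1 (mem_box.1 hx i)
  obtain ⟨u, v, hu, hv, huv, -, hj⟩ := Joined.last_exit (A := {z | -(s : ℤ) ≤ z i}) hxy
    hxi.1 (by simp only [Set.mem_ofPred_eq]; omega)
  simp only [Set.mem_ofPred_eq] at hu hv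
  have huv' := abs_le.1 (abs_sub_le_one_of_adj huv i)
  have hvi : v i = -(s : ℤ) - 1 := by omega
  obtain ⟨w, hw, hvw⟩ := exists_boxIndex (k := 2 * M + 1) hn (v := v) fun j => by
    have h1 := mem_box.1 (Joined.left_mem hj).1.2 j
    have h2 : 2 * s + 1 ≤ n * (2 * M + 1) := by rw [hs]; nlinarith
    exact h1.trans (by exact_mod_cast h2)
  refine Set.mem_biUnion hw ?_
  -- The `i`-th coordinate is prescribed so that `v i = -s - 1` is sent exactly to `-n`; the value
  -- of `w i` is discarded.
  set t : Fin d → ℤ := Function.update ((n : ℤ) • w) i (n - (s : ℕ) - 1) with ht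
  have hti : t i = n - s - 1 := by simp [ht]
  have hvt : v - t ∈ box d n := mem_box.2 fun j => by
    by_cases hji : j = i
    · subst hji
      rw [Pi.sub_apply, hti, hvi, abs_le]
      omega
    · have : t j = ((n : ℤ) • w) j := by simp [ht, hji]
      rw [Pi.sub_apply, this]
      exact mem_box.1 hvw j
  have hyt : y - t ∉ box d s := notMem_box.2 ⟨i, by
    rw [Pi.sub_apply, hti, lt_abs]
    omega⟩
  have hconn : ConnectedIn ω {z | z i < -(s : ℤ)} v y := hj.mono fun z hz => by
    have hz2 := hz.2
    simp only [Set.mem_ofPred_eq] at hz2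
    exact ⟨hz.1.1, by simp only [Set.mem_ofPred_eq]; omega⟩
  have hconn' := hconn.shift_neg (W' := {z | z i ≤ -(n : ℤ)}) (a := t) fun z hz => by
    simp only [Set.mem_ofPred_eq, Pi.sub_apply, hti] at hz ⊢
    omega
  obtain ⟨r, hr, hvr⟩ := exists_connectedIn_boxBoundary (box_mono hns hvt) hyt hconn'
  exact ⟨v - t, r, ⟨hvt, hr⟩, hvr⟩

theorem real_directedArm_le (p : unitInterval) (i : Fin d) {M n : ℕ} (hM : 1 ≤ M) (hn : 0 < n) :
    (P d p).real (directedArm i (M * n)) ≤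
      (4 * M + 3 : ℝ) ^ d * (P d p).real (lowerArm i n (M * n)) := by
  refine (measureReal_mono (directedArm_subset i hM hn) (measure_ne_top _ _)).trans
    ((measureReal_biUnion_finset_le _ _).trans (le_of_eq ?_))
  simp_rw [real_preimage_comp_equiv]
  rw [Finset.sum_const, card_boxIndex, nsmul_eq_mul]
  push_cast
  ring

theorem armEvent_subset (s : ℕ) : armEvent d s (2 * s) ⊆
    ⋃ i ∈ (Finset.univ : Finset (Fin d)),
      directedArm i s ∪ {ω | ω ∘ Equiv.neg _ ∈ directedArm i s} := by
  rintro ω ⟨x, y, ⟨hx, hy⟩, hxy⟩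
  rw [sub_zero] at hx hy
  obtain ⟨i, hi⟩ := notMem_box.1 hy
  refine Set.mem_biUnion (Finset.mem_univ i) ?_
  rw [lt_abs] at hi
  push_cast at hi
  rcases hi with hi | hi
  · refine Or.inr ⟨-x, -y, ⟨neg_mem_box hx, by rw [Pi.neg_apply]; omega⟩, ?_⟩
    refine ConnectedIn.neg ?_ fun z hz => neg_mem_box hz
    convert hxy using 1
    ext z
    simp
  · exact Or.inl ⟨x, y, ⟨hx, by omega⟩, hxy⟩

/-- Choosing the direction with the largest half-space probability replaces an appeal to symmetry
under permuting coordinates. -/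
theorem exists_real_armEvent_le (p : unitInterval) (hd : 0 < d) {M n : ℕ} (hM : 1 ≤ M)
    (hn : 0 < n) : ∃ i : Fin d, (P d p).real (armEvent d (M * n) (2 * (M * n))) ≤
      2 * d * (4 * M + 3 : ℝ) ^ d * (P d p).real (lowerArm i n (M * n)) := by
  have : Nonempty (Fin d) := ⟨⟨0, hd⟩⟩
  obtain ⟨i, -, hi⟩ := Finset.exists_max_image (Finset.univ : Finset (Fin d))
    (fun i => (P d p).real (lowerArm i n (M * n))) Finset.univ_nonempty
  refine ⟨i, ?_⟩
  have hterm : ∀ j : Fin d, (P d p).real (directedArm j (M * n) ∪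
      {ω | ω ∘ Equiv.neg _ ∈ directedArm j (M * n)}) ≤
      2 * ((4 * M + 3 : ℝ) ^ d * (P d p).real (lowerArm i n (M * n))) := by
    intro j
    refine (measureReal_union_le _ _).trans ?_
    rw [real_preimage_comp_equiv, ← two_mul]
    gcongr
    refine (real_directedArm_le p j hM hn).trans ?_
    exact mul_le_mul_of_nonneg_left (hi j (Finset.mem_univ j)) (by positivity)
  refine (measureReal_mono (armEvent_subset _) (measure_ne_top _ _)).trans
    ((measureReal_biUnion_finset_le _ _).trans
      ((Finset.sum_le_sum fun j _ => hterm j).trans (le_of_eq ?_)))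
  rw [Finset.sum_const, nsmul_eq_mul, Finset.card_univ, Fintype.card_fin]
  ring

/-- With `n = 4Mm` a slab crossing advances `8Mm - 2`, enough to leave radius `(2M+1)m` around a
grid point within `m` of its start. Since `Λ(Mn) = Λ(4M²m)`, grid indices up to `4M²` suffice. -/
theorem slabCrossing_subset (i : Fin d) {M m : ℕ} (hM : 1 ≤ M) (hm : 0 < m) :
    slabCrossing i (4 * M * m) (M * (4 * M * m)) ⊆ ⋃ w ∈ boxIndex d (4 * M ^ 2),
      crossing (slab i (4 * M * m) (M * (4 * M * m))) ((m : ℤ) • w) m ((2 * M + 1) * m) := by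
  rintro ω ⟨x, y, ⟨hx, hy⟩, hxy⟩
  obtain ⟨w, hw, hxw⟩ := exists_boxIndex (k := 4 * M ^ 2) hm (v := x) fun j => by
    refine (mem_box.1 (Joined.left_mem hxy).2.2 j).trans (le_of_eq ?_)
    push_cast
    ring
  refine Set.mem_biUnion hw ⟨x, y, ⟨hxw, notMem_box.2 ⟨i, ?_⟩⟩, hxy⟩
  have h1 := abs_le.1 (mem_box.1 hxw i)
  rw [Pi.sub_apply] at h1 ⊢
  have h2 : (m : ℤ) ≤ M * m := by exact_mod_cast Nat.le_mul_of_pos_left m hM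
  have h3 : (1 : ℤ) ≤ m := by exact_mod_cast hm
  rw [lt_abs]
  left
  push_cast at *
  linarith

/-- By Harris, the chance that none of the `(8M²+1)^d` covering boxes has an arm is at least the
product of the individual chances. -/
theorem pow_le_real_slabCrossing_compl (p : unitInterval) (i : Fin d) {M m : ℕ} (hM : 1 ≤ M)
    (hm : 0 < m) : (1 - (P d p).real (armEvent d m ((2 * M + 1) * m))) ^ (8 * M ^ 2 + 1) ^ d ≤
      (P d p).real (slabCrossing i (4 * M * m) (M * (4 * M * m)))ᶜ := by
  have h := LocalOn.prod_le_real_iInter_compl (boxIndex d (4 * M ^ 2))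
    (E := fun w => crossing (slab i (4 * M * m) (M * (4 * M * m))) ((m : ℤ) • w) m
      ((2 * M + 1) * m)) (finite_slab i _ _) (fun w => localOn_crossing _ _ _ _)
    (fun w => isUpperSet_linkEvent _ _) p
  refine le_trans ?_ (h.trans
    (measureReal_mono (Set.compl_subset_compl.2 (slabCrossing_subset i hM hm))))
  have hcard : (8 * M ^ 2 + 1) ^ d = (boxIndex d (4 * M ^ 2)).card := by
    rw [card_boxIndex]; ring
  rw [hcard, ← Finset.prod_const]
  refine Finset.prod_le_prod (fun w _ => sub_nonneg.2 measureReal_le_one) fun w _ => ?_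
  exact sub_le_sub_left (real_crossing_le p _ _ (by nlinarith)) 1

theorem real_slabCrossing_compl_pos {p : unitInterval} (hp : p < 1) (i : Fin d) (n N : ℕ) :
    0 < (P d p).real (slabCrossing i n N)ᶜ := by
  refine (real_forall_closed p (finite_slab i n N) hp).trans_le (measureReal_mono ?_)
  rintro ω hω ⟨x, y, -, hxy⟩
  have h := Joined.left_mem hxy
  have h' := hω x h.2
  rw [h.1] at h'
  exact Bool.noConfusion h'

end HalfSpaces

end SitePercolation

namespace SitePercolation

/-! ### Both criteria at `p_c` and the choice of the next scale -/

section Critical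

variable {d : ℕ}

theorem joined_box_zero {n : ℕ} {x : Fin d → ℤ} (hx : x ∈ box d n) : Joined (box d n) x 0 := by
  induction hN : ∑ i, (x i).natAbs using Nat.strong_induction_on generalizing x with
  | _ N ih =>
    by_cases h0 : x = 0
    · subst h0; exact Joined.refl hx
    obtain ⟨i, hi⟩ := Function.ne_iff.1 h0
    rw [Pi.zero_apply] at hi
    set y := Function.update x i (x i - (x i).sign) with hy
    have hyi : y i = x i - (x i).sign := by simp [hy]
    have hyj : ∀ j, j ≠ i → y j = x j := fun j hj => by simp [hy, hj]
    have hsign : (0 < x i ∧ (x i).sign = 1) ∨ (x i < 0 ∧ (x i).sign = -1) := by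
      rcases lt_or_gt_of_ne hi with h | h
      · exact Or.inr ⟨h, Int.sign_eq_neg_one_of_neg h⟩
      · exact Or.inl ⟨h, Int.sign_eq_one_of_pos h⟩
    have hxi := abs_le.1 (mem_box.1 hx i)
    have hybox : y ∈ box d n := mem_box.2 fun j => by
      by_cases hj : j = i
      · subst hj
        rw [hyi, abs_le]
        omega
      · rw [hyj j hj]; exact mem_box.1 hx j
    have hadj : (lattice d).Adj x y := by
      change ∑ j, |x j - y j| = 1
      rw [Finset.sum_eq_single i (fun j _ hj => by rw [hyj j hj]; simp) (by simp), hyi]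
      rcases hsign with h | h <;> simp [h.2]
    have hlt : ∑ j, (y j).natAbs < N := by
      rw [← hN]
      refine Finset.sum_lt_sum (fun j _ => ?_) ⟨i, Finset.mem_univ i, by rw [hyi]; omega⟩
      by_cases hj : j = i
      · subst hj; rw [hyi]; omega
      · rw [hyj j hj]
    exact (Joined.of_adj hx hybox hadj).trans (ih _ hlt hybox rfl)

theorem P_one : P d 1 = Measure.dirac fun _ => true := by
  unfold P
  simp_rw [bernoulliMeasure_one]
  exact Measure.infinitePi_dirac _

theorem P_zero : P d 0 = Measure.dirac fun _ => false := by
  unfold P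
  simp_rw [bernoulliMeasure_zero]
  exact Measure.infinitePi_dirac _

theorem theta_zero : theta d 0 = 0 := by
  refine theta_eq_zero_of_arm_small 0 (s := 1) one_pos ?_
  have h : (P d 0).real (armEvent d 1 (2 * 1)) = 0 := by
    rw [measureReal_def, P_zero, Measure.dirac_apply' _
      ((localOn_armEvent _ _).measurableSet (finite_box _)), Set.indicator_of_notMem]
    · simp
    · rintro ⟨x, y, -, hxy⟩
      exact Bool.noConfusion (Joined.left_mem hxy).1
  rw [h]
  norm_num

theorem connectedIn_true {n : ℕ} {x y : Fin d → ℤ} (hx : x ∈ box d n) (hy : y ∈ box d n) :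
    ConnectedIn (fun _ => true) (box d n) x y :=
  Joined.mono ((joined_box_zero hx).trans (joined_box_zero hy).symm) fun _ hz => ⟨rfl, hz⟩

theorem real_one_armEvent (hd : 0 < d) (m n : ℕ) : (P d 1).real (armEvent d m n) = 1 := by
  rw [measureReal_def, P_one, Measure.dirac_apply' _
    ((localOn_armEvent _ _).measurableSet (finite_box _)), Set.indicator_of_mem]
  · simp
  · refine ⟨0, fun _ => n + 1, ⟨by simp [mem_box], notMem_box.2 ⟨⟨0, hd⟩, ?_⟩⟩,
      connectedIn_true (by simp [mem_box]; omega) (mem_box.2 fun i => ?_)⟩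
    · rw [Pi.sub_apply, lt_abs]; left; simp
    · rw [abs_le]; push_cast; omega

theorem real_one_twoArmEvent (m n : ℕ) : (P d 1).real (twoArmEvent d m n) = 0 := by
  rw [measureReal_def, P_one, Measure.dirac_apply' _
    ((localOn_twoArmEvent _ _).measurableSet (finite_box _)), Set.indicator_of_notMem]
  · simp
  · rintro ⟨C, C', ⟨x, hx, -, rfl⟩, ⟨y, hy, -, rfl⟩, hne, -⟩
    refine hne (Set.ext fun z => ⟨fun hz => ?_, fun hz => ?_⟩)
    · exact Joined.trans (connectedIn_true hy hx) hz
    · exact Joined.trans (connectedIn_true hx hy) hz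

/-- Only that `p_c` is the supremum of a nonempty set enters, neither monotonicity of `θ` nor the
value `θ(p_c)`. -/
theorem criticalProb_mem_closure :
    criticalProb d ∈ closure {p : unitInterval | theta d p = 0} :=
  (isLUB_sSup _).mem_closure ⟨0, theta_zero⟩

/-- The finite-size criterion for percolation fails on the closure of the set where
`θ` vanishes. -/
theorem le_of_mem_closure (hd : 2 ≤ d) {p : unitInterval}
    (hp : p ∈ closure {p : unitInterval | theta d p = 0}) {M m : ℕ} (hM : 1 ≤ M) (hm : 0 < m) :
    1 / 4 ≤ (8 * M + 11 : ℝ) ^ 4 * ((1 - (P d p).real (armEvent d m ((2 * M + 1) * m))) +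
      (P d p).real (twoArmEvent d (2 * m) (M * (2 * m)))) := by
  have hcont : Continuous fun p : unitInterval => (8 * M + 11 : ℝ) ^ 4 *
      ((1 - (P d p).real (armEvent d m ((2 * M + 1) * m))) +
        (P d p).real (twoArmEvent d (2 * m) (M * (2 * m)))) := by
    have h1 := (localOn_armEvent (d := d) m ((2 * M + 1) * m)).continuous (finite_box _)
    have h2 := (localOn_twoArmEvent (d := d) (2 * m) (M * (2 * m))).continuous (finite_box _)
    exact continuous_const.mul ((continuous_const.sub h1).add h2)
  refine closure_minimal (fun q hq => ?_) (isClosed_le continuous_const hcont) hp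
  by_contra hlt
  exact (theta_pos_of_unique_crossing hd q hM hm (not_le.1 hlt).le).ne' hq

/-- At `p = 1` arms are certain and two distinct clusters impossible, so the percolation criterion
holds there; it cannot hold at `p_c`. -/
theorem criticalProb_lt_one (hd : 2 ≤ d) : criticalProb d < 1 := by
  refine lt_of_le_of_ne unitInterval.le_one' fun h => ?_
  have h1 := le_of_mem_closure hd criticalProb_mem_closure (M := 1) (m := 1) le_rfl one_pos
  rw [h, real_one_armEvent (by omega), real_one_twoArmEvent] at h1
  norm_num at h1

/-- For `p > p_c` the bound holds because `θ(p) ≠ 0`. It passes to the limit `p ↓ p_c`, which exists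
since `p_c < 1`. -/
theorem le_real_armEvent_criticalProb (hd : 2 ≤ d) {s : ℕ} (hs : 0 < s) :
    1 ≤ 9 ^ d * (P d (criticalProb d)).real (armEvent d s (2 * s)) := by
  have hcont : Continuous fun p : unitInterval =>
      9 ^ d * (P d p).real (armEvent d s (2 * s)) :=
    continuous_const.mul ((localOn_armEvent s (2 * s)).continuous (finite_box _))
  have hsub : Set.Ioi (criticalProb d) ⊆
      {p | 1 ≤ 9 ^ d * (P d p).real (armEvent d s (2 * s))} := by
    intro p hp
    by_contra hlt
    have h0 := theta_eq_zero_of_arm_small p hs (not_le.1 hlt)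
    exact (le_sSup (a := p) h0).not_gt hp
  have hcl : criticalProb d ∈ closure (Set.Ioi (criticalProb d)) := by
    have hne : (Set.Ioi (criticalProb d)).Nonempty := ⟨1, criticalProb_lt_one hd⟩
    rw [closure_Ioi' hne]
    exact Set.self_mem_Ici
  exact closure_minimal hsub (isClosed_le continuous_const hcont) hcl

/-- At criticality arms confined to a half space have probability bounded below at all scales. -/
theorem exists_le_real_lowerArm (hd : 2 ≤ d) {M : ℕ} (hM : 1 ≤ M) :
    ∃ ε : ℝ, 0 < ε ∧ ∀ n : ℕ, 0 < n → ∃ i : Fin d,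
      ε ≤ (P d (criticalProb d)).real (lowerArm i n (M * n)) := by
  have hd' : (0 : ℝ) < d := by exact_mod_cast (by omega : 0 < d)
  have hc : (0 : ℝ) < 9 ^ d * (2 * d * (4 * M + 3 : ℝ) ^ d) := by positivity
  refine ⟨1 / (9 ^ d * (2 * d * (4 * M + 3 : ℝ) ^ d)), by positivity, fun n hn => ?_⟩
  obtain ⟨i, hi⟩ := exists_real_armEvent_le (criticalProb d) (show 0 < d by omega) hM hn
  refine ⟨i, ?_⟩
  have h1 := le_real_armEvent_criticalProb hd (s := M * n) (by positivity)
  have h2 := mul_le_mul_of_nonneg_left hi (show (0 : ℝ) ≤ 9 ^ d by positivity)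
  rw [div_le_iff₀ hc]
  linarith

theorem exists_le_real_twoArmEvent (hd : 2 ≤ d) {M : ℕ} (hM : 2 ≤ M) :
    ∃ δ : ℝ, 0 < δ ∧ ∀ N : ℕ, 0 < N → ∃ n, N < n ∧ n ≤ 8 * M * N ∧
      δ ≤ (P d (criticalProb d)).real (twoArmEvent d n (M * n)) := by
  obtain ⟨ε, hε, harm⟩ := exists_le_real_lowerArm hd (M := M) (by omega)
  -- If both terms of the criterion were below `η`, their weighted sum would be below `1/8 + 1/8 =
  -- 1/4`.
  set η : ℝ := 1 / (8 * (8 * M + 11 : ℝ) ^ 4) with hη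
  have hη0 : 0 < η := by positivity
  refine ⟨min η (ε ^ 2 * η ^ (8 * M ^ 2 + 1) ^ d), by positivity, fun N hN => ?_⟩
  have hcrit := le_of_mem_closure hd criticalProb_mem_closure (M := M) (m := N) (by omega) hN
  by_cases h : η ≤ (P d (criticalProb d)).real (twoArmEvent d (2 * N) (M * (2 * N)))
  · exact ⟨2 * N, by omega, by nlinarith, (min_le_left _ _).trans h⟩
  · have hf : η ≤ 1 - (P d (criticalProb d)).real (armEvent d N ((2 * M + 1) * N)) := by
      have h8 : (8 * M + 11 : ℝ) ^ 4 * η = 1 / 8 := by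
        rw [hη]; field_simp
      have hpos : (0 : ℝ) < (8 * M + 11 : ℝ) ^ 4 := by positivity
      by_contra hlt
      nlinarith
    obtain ⟨i, hi⟩ := harm (4 * M * N) (by positivity)
    refine ⟨4 * M * N, by nlinarith, by nlinarith, (min_le_right _ _).trans
      (le_trans ?_ (mul_le_real_twoArmEvent _ i (by positivity)))⟩
    gcongr
    exact (pow_le_pow_left₀ hη0.le hf _).trans
      (pow_le_real_slabCrossing_compl _ i (by omega) hN)

/-- Covers the scale `n = 1`, which is prescribed as the start of the sequence and is not produced
as the successor of a positive scale. -/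
theorem real_twoArmEvent_pos (hd : 2 ≤ d) {M : ℕ} (hM : 1 ≤ M) {n : ℕ} (hn : 0 < n) :
    0 < (P d (criticalProb d)).real (twoArmEvent d n (M * n)) := by
  obtain ⟨ε, hε, harm⟩ := exists_le_real_lowerArm hd hM
  obtain ⟨i, hi⟩ := harm n hn
  refine lt_of_lt_of_le ?_ (mul_le_real_twoArmEvent _ i hn)
  exact mul_pos (pow_pos (hε.trans_le hi) 2)
    (real_slabCrossing_compl_pos (criticalProb_lt_one hd) i _ _)

end Critical

end SitePercolation

theorem proposition2 (d : ℕ) (hd : 2 ≤ d) (M : ℕ) (hM : 2 ≤ M) :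
    ∃ δ : ℝ, 0 < δ ∧ ∃ n : ℕ → ℕ, n 0 = 1 ∧ StrictMono n ∧
      (∀ i, (n (i + 1) : ℝ) / (n i : ℝ) ≤ 8 * (M : ℝ)) ∧
      ∀ i, δ ≤ (SitePercolation.P d (SitePercolation.criticalProb d)).real
        (SitePercolation.twoArmEvent d (n i) (M * n i)) := by
  obtain ⟨δ, hδ, hnext⟩ := SitePercolation.exists_le_real_twoArmEvent hd hM
  have h1 := SitePercolation.real_twoArmEvent_pos hd (M := M) (by omega) one_pos
  choose! f hlt hle hf using hnext
  let n : ℕ → ℕ := fun i => f^[i] 1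
  have hsucc : ∀ i, n (i + 1) = f (n i) := fun i => Function.iterate_succ_apply' f i 1
  have hpos : ∀ i, 0 < n i := by
    intro i
    induction i with
    | zero => exact one_pos
    | succ i ih => rw [hsucc]; exact (hlt _ ih).trans' ih
  -- The second entry of the minimum is the probability of `A₂(1, M)`, needed only for the first
  -- term.
  refine ⟨min δ _, lt_min hδ h1, n, rfl, strictMono_nat_of_lt_succ fun i => ?_,
    fun i => ?_, fun i => ?_⟩
  · rw [hsucc]; exact hlt _ (hpos i)
  · rw [div_le_iff₀ (by exact_mod_cast hpos i), hsucc]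
    exact_mod_cast hle _ (hpos i)
  · cases i with
    | zero => exact min_le_right _ _
    | succ i => rw [hsucc]; exact (min_le_left _ _).trans (hf _ (hpos i))
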